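/- Let $P$ be any probability distribution on $\mathbb{Z}_+=\{0,1,2,\ldots\}$, let $Y\sim P$, let $Q$ be any probability distribution on $\mathbb{N}=\{1,2,\ldots\}$ and let $\lambda>0$. Let $\mathrm{CPo}(\lambda,Q)$ be the compound Poisson law, i.e. the distribution of $\sum_{i=1}^{Z}X_i$, where $Z$ is Poisson with parameter $\lambda$ and the $X_i$ are i.i.d. with distribution $Q$, independent of $Z$. Then $$d_{\mathrm{TV}}(P,\mathrm{CPo}(\lambda,Q))\;\le\; H(\lambda,Q)\,\sqrt{J_{Q,2}(Y)} ,$$ where the quantities are as follows. The total variation distance is $d_{\mathrm{TV}}(P,R)=\frac12\sum_{x\ge 0}|P(x)-R(x)|$. The Katti–Panjer information of $Y$ relative to $Q$ (with parameter $\lambda$) is $$J_{Q,2}(Y)=E\big[r_2(Y;P,Q)^2\big]\in[0,\infty],\qquad r_2(y;P,Q)=\frac{\lambda\sum_{j=1}^{\infty} jQ(j)P(y-j)}{P(y)}-y\quad(y\in\mathbb{Z}_+),$$ where $P(k)=0$ for $k<0$, where $\lambda$ is the same number as in $\mathrm{CPo}(\lambda,Q)$, and where $J_{Q,2}(Y)=\infty$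 if $P$ does not have full support on $\mathbb{Z}_+$. (When $Y$ and $Q$ have finite means and $EY>0$, the customary choice is $\lambda=E Y/\sum_j jQ(j)$, but the inequality holds for every $\lambda>0$, and no finiteness of means is assumed.) The Stein factor $H(\lambda,Q)$ is defined by $$H(\lambda,Q)=\begin{cases}H_0(\lambda,Q), & \text{if the sequence } (jQ(j))_{j\ge1}\text{ is non-increasing},\\[2pt] e^{\lambda}\min\Big\{1,\dfrac{1}{\lambda Q(1)}\Big\}, & \text{otherwise,}\end{cases}$$ where, with $\delta=[\lambda\{Q(1)-2Q(2)\}]^{-1}$, $$H_0(\lambda,Q)=\begin{cases}1, & \text{if }\delta\ge1,\\ \sqrt{\delta}\,(2-\sqrt{\delta}), & \text{if }\delta<1,\end{cases}$$ and reciprocals of $0$ are read as $+\infty$. -/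

import Mathlib

open scoped ENNReal NNReal

noncomputable section

/-- The law of `X₁ + ⋯ + Xₙ`, where the `Xᵢ` are i.i.d. with distribution `Q`
(the empty sum is `0`). -/
def iidSum (Q : PMF ℕ) : ℕ → PMF ℕ
  | 0 => PMF.pure 0
  | n + 1 => (iidSum Q n).bind fun s => Q.map fun x => s + x

/-- The compound distribution `C_Q R`: the law of `X₁ + ⋯ + X_N` with `N ∼ R` and the `Xᵢ`
i.i.d. with distribution `Q`, independent of `N`. -/
def compoundPMF (Q R : PMF ℕ) : PMF ℕ := R.bind (iidSum Q)

/-- The compound Poisson law `CPo(lam, Q) = C_Q Po(lam)` (for `lam > 0`). -/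
def compoundPoisson (lam : ℝ) (Q : PMF ℕ) : PMF ℕ :=
  compoundPMF Q (ProbabilityTheory.poissonMeasure lam.toNNReal).toPMF

/-- Total variation distance, `½ ∑ₓ |P(x) - R(x)|`. -/
def tvDist (P R : PMF ℕ) : ℝ := (1 / 2) * ∑' x, |(P x).toReal - (R x).toReal|

/-- The sequence `j Q(j)`, `j = 1, 2, …`, is non-increasing. -/
def IsNonincreasingWeights (Q : PMF ℕ) : Prop :=
  AntitoneOn (fun j : ℕ => (j : ℝ) * (Q j).toReal) (Set.Ici 1)

/-- `δ = [lam (Q(1) - 2 Q(2))]⁻¹`, read as `∞` when `Q(1) = 2 Q(2)`. It is used only when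
`j Q(j)` is non-increasing, so that `Q(1) - 2 Q(2) ≥ 0`. -/
def steinDelta (lam : ℝ) (Q : PMF ℕ) : ℝ≥0∞ :=
  (ENNReal.ofReal (lam * ((Q 1).toReal - 2 * (Q 2).toReal)))⁻¹

open Classical in
/-- `H₀(lam, Q)`. -/
def steinFactorZero (lam : ℝ) (Q : PMF ℕ) : ℝ :=
  if 1 ≤ steinDelta lam Q then 1
  else √(steinDelta lam Q).toReal * (2 - √(steinDelta lam Q).toReal)

open Classical in
/-- The Stein factor `H(lam, Q)`. The reciprocal `1 / (lam Q(1))` is read as `∞` when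
`Q(1) = 0`, so that the minimum is then `1`. -/
def steinFactor (lam : ℝ) (Q : PMF ℕ) : ℝ :=
  if IsNonincreasingWeights Q then steinFactorZero lam Q
  else Real.exp lam * (min 1 (ENNReal.ofReal (lam * (Q 1).toReal))⁻¹).toReal

/-- The score `r₂(y; P, Q) = lam (∑_{j ≥ 1} j Q(j) P(y - j)) / P(y) - y` with parameter `lam`.
Since `P` vanishes on negative integers, the sum is over `1 ≤ j ≤ y`. It is used only at
points `y` with `P(y) > 0`. -/
def kattiPanjerScore (lam : ℝ) (P Q : PMF ℕ) (y : ℕ) : ℝ :=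
  lam * (∑ j ∈ Finset.Icc 1 y, (j : ℝ) * (Q j).toReal * (P (y - j)).toReal) / (P y).toReal - y

open Classical in
/-- The Katti-Panjer information `J_{Q,2}(Y) = E[r₂(Y; P, Q)²]` of `Y ∼ P`, with values in
`[0, ∞]`. It is infinite unless `P` has full support on `{0, 1, 2, …}`. -/
def kattiPanjerInfo (lam : ℝ) (P Q : PMF ℕ) : ℝ≥0∞ :=
  if ∀ y, P y ≠ 0 then ∫⁻ y, ENNReal.ofReal (kattiPanjerScore lam P Q y ^ 2) ∂P.toMeasure
  else ⊤

end

/-! Stein's method is run in dual form, on generating series instead of test functions. With `L =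
lam • pmfSeries Q`, the series of `CPo(lam, Q)` is `exp(-lam) • expS L`, and the multiples of `expS
L` are exactly the solutions of `A' = L' A`. The series of `P` fails this equation by `scoreSeries`,
whose coefficients are `P(y) r₂(y)` for `y ≥ 1` when `P` has full support. By Cauchy–Schwarz its
`ℓ¹` norm is at most the square root of the information.

Let `D_m = steinSol L m`, that is, `D_m(z) = exp(L(z)) ∫_z^1 s^m exp(-L(s)) ds`; it has mass `0` and
satisfies `D_m' = L' D_m - X^m`. Superposing the `D_m` with the score coefficients gives a series
`W` of mass `0` with the same defect as `P`. Hence `P - W` solves the homogeneous equation and has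
mass `1`, so it is the compound Poisson series. Total variation is half the norm of `W`, and it
remains to show `‖D_m‖₁ ≤ 2 H`.

For general `Q`, `D_m` is a difference of two series with nonnegative coefficients and equal mass
`exp(lam) ∫_0^1 s^m exp(-L(s)) ds`; the integral is at most `min(1, 1/(lam Q(1)))`.

For non-increasing `j Q(j)`, put `s = u + (1 - u) z`. Then `D_m` is the integral over `u ∈ (0, 1)`
of `(1 - z) exp(L(z) - L(s)) s^m`. Monotonicity makes the coefficients of `L(z) - L(s)` nonnegative
in positive degrees, with at least `a u` in degree one, where `a = lam (Q(1) - 2 Q(2))`. The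
integrand is thus `(1 - z)` times a Poisson series of mean `a u` times a probability series, and
smoothing bounds its norm by `2` and by `(a u)^(-1/2)`. Integration gives `2` and `2 a^(-1/2)`; the
latter is even sharper than `2 H₀` when `δ < 1`. -/

noncomputable section
namespace CompoundPoissonStein
open PowerSeries MeasureTheory Filter Topology
open Set (Icc Ioo Ioc Ico Ici)

/-! ### Absolutely summable power series -/

/-- The `ℓ¹` norm of the coefficient sequence. -/
def l1 (A : ℝ⟦X⟧) : ℝ≥0∞ := ∑' n, ‖coeff n A‖ₑ

/-- The sum of a power series at `z`. -/
def ev (z : ℝ) (A : ℝ⟦X⟧) : ℝ := ∑' n, coeff n A * z ^ n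

theorem l1_add_le (A B : ℝ⟦X⟧) : l1 (A + B) ≤ l1 A + l1 B := by
  rw [l1, l1, l1, ← ENNReal.tsum_add]
  exact ENNReal.tsum_le_tsum fun n => by simpa using enorm_add_le _ _

theorem l1_smul (c : ℝ) (A : ℝ⟦X⟧) : l1 (c • A) = ‖c‖ₑ * l1 A := by
  rw [l1, l1, ← ENNReal.tsum_mul_left]
  exact tsum_congr fun n => by simp [enorm_mul]

theorem l1_neg (A : ℝ⟦X⟧) : l1 (-A) = l1 A := by simp [l1]

theorem l1_sub_le (A B : ℝ⟦X⟧) : l1 (A - B) ≤ l1 A + l1 B := by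
  rw [sub_eq_add_neg, ← l1_neg B]; exact l1_add_le _ _

theorem l1_mul_le (A B : ℝ⟦X⟧) : l1 (A * B) ≤ l1 A * l1 B := by
  calc l1 (A * B)
      ≤ ∑' n, ∑ p ∈ Finset.HasAntidiagonal.antidiagonal n, ‖coeff p.1 A‖ₑ * ‖coeff p.2 B‖ₑ := by
        refine ENNReal.tsum_le_tsum fun n => ?_
        rw [coeff_mul]
        refine (enorm_sum_le _ _).trans (le_of_eq ?_)
        exact Finset.sum_congr rfl fun p _ => enorm_mul _ _
    _ = ∑' p : ℕ × ℕ, ‖coeff p.1 A‖ₑ * ‖coeff p.2 B‖ₑ := by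
        rw [← Finset.HasAntidiagonal.sigmaAntidiagonalEquivProd.tsum_eq, ENNReal.tsum_sigma']
        refine tsum_congr fun n => ?_
        rw [tsum_fintype, ← Finset.sum_coe_sort]
        rfl
    _ = l1 A * l1 B := by
        rw [ENNReal.tsum_prod', l1, l1, ← ENNReal.tsum_mul_right]
        exact tsum_congr fun n => by rw [← ENNReal.tsum_mul_left]

theorem l1_one : l1 1 = 1 := by
  rw [l1, tsum_eq_single 0]
  · simp
  · intro n hn; simp [coeff_one, hn]

theorem l1_X : l1 X = 1 := by
  rw [l1, tsum_eq_single 1]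
  · simp
  · intro n hn; simp [coeff_X, hn]

theorem l1_pow_le (A : ℝ⟦X⟧) (k : ℕ) : l1 (A ^ k) ≤ l1 A ^ k := by
  induction k with
  | zero => simp [l1_one]
  | succ k ih => rw [pow_succ, pow_succ]; exact (l1_mul_le _ _).trans (by gcongr)

theorem summable_abs_coeff {A : ℝ⟦X⟧} (hA : l1 A ≠ ∞) : Summable fun n => |coeff n A| := by
  have := ENNReal.summable_toReal hA
  simpa using this

theorem l1_ne_top_of_summable {A : ℝ⟦X⟧} (hA : Summable fun n => |coeff n A|) : l1 A ≠ ∞ := by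
  have := hA.tsum_ofReal_ne_top
  simpa [l1, Real.enorm_eq_ofReal_abs] using this

theorem summable_abs_coeff_mul_pow {A : ℝ⟦X⟧} (hA : l1 A ≠ ∞) {z : ℝ} (hz : |z| ≤ 1) :
    Summable fun n => |coeff n A * z ^ n| := by
  refine (summable_abs_coeff hA).of_nonneg_of_le (fun n => abs_nonneg _) fun n => ?_
  rw [abs_mul, abs_pow]
  exact mul_le_of_le_one_right (abs_nonneg _) (pow_le_one₀ (abs_nonneg _) hz)

theorem summable_coeff_mul_pow {A : ℝ⟦X⟧} (hA : l1 A ≠ ∞) {z : ℝ} (hz : |z| ≤ 1) :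
    Summable fun n => coeff n A * z ^ n := (summable_abs_coeff_mul_pow hA hz).of_abs

theorem ev_mul {A B : ℝ⟦X⟧} (hA : l1 A ≠ ∞) (hB : l1 B ≠ ∞) {z : ℝ} (hz : |z| ≤ 1) :
    ev z (A * B) = ev z A * ev z B := by
  rw [ev, ev, ev, tsum_mul_tsum_eq_tsum_sum_antidiagonal_of_summable_norm
    (summable_coeff_mul_pow hA hz).norm (summable_coeff_mul_pow hB hz).norm]
  refine tsum_congr fun n => ?_
  rw [coeff_mul, Finset.sum_mul]
  refine Finset.sum_congr rfl fun p hp => ?_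
  rw [← Finset.HasAntidiagonal.mem_antidiagonal.1 hp, pow_add]; ring

theorem ev_add {A B : ℝ⟦X⟧} (hA : l1 A ≠ ∞) (hB : l1 B ≠ ∞) {z : ℝ} (hz : |z| ≤ 1) :
    ev z (A + B) = ev z A + ev z B := by
  rw [ev, ev, ev, ← (summable_coeff_mul_pow hA hz).tsum_add (summable_coeff_mul_pow hB hz)]
  exact tsum_congr fun n => by simp [add_mul]

theorem ev_smul (c : ℝ) (A : ℝ⟦X⟧) (z : ℝ) : ev z (c • A) = c * ev z A := by
  rw [ev, ev, ← tsum_mul_left]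
  exact tsum_congr fun n => by simp [mul_assoc]

theorem ev_neg (A : ℝ⟦X⟧) (z : ℝ) : ev z (-A) = -ev z A := by
  simpa using ev_smul (-1) A z

theorem ev_sub {A B : ℝ⟦X⟧} (hA : l1 A ≠ ∞) (hB : l1 B ≠ ∞) {z : ℝ} (hz : |z| ≤ 1) :
    ev z (A - B) = ev z A - ev z B := by
  rw [sub_eq_add_neg, ev_add hA (by rwa [l1_neg]) hz, ev_neg, sub_eq_add_neg]

theorem ev_one (z : ℝ) : ev z 1 = 1 := by
  rw [ev, tsum_eq_single 0]
  · simp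
  · intro n hn; simp [coeff_one, hn]

theorem ev_X (z : ℝ) : ev z X = z := by
  rw [ev, tsum_eq_single 1]
  · simp
  · intro n hn; simp [coeff_X, hn]

theorem l1_pow_ne_top {A : ℝ⟦X⟧} (hA : l1 A ≠ ∞) (k : ℕ) : l1 (A ^ k) ≠ ∞ :=
  ne_top_of_le_ne_top (ENNReal.pow_ne_top hA) (l1_pow_le A k)

theorem l1_mul_ne_top {A B : ℝ⟦X⟧} (hA : l1 A ≠ ∞) (hB : l1 B ≠ ∞) : l1 (A * B) ≠ ∞ :=
  ne_top_of_le_ne_top (ENNReal.mul_ne_top hA hB) (l1_mul_le A B)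

theorem l1_smul_ne_top (c : ℝ) {A : ℝ⟦X⟧} (hA : l1 A ≠ ∞) : l1 (c • A) ≠ ∞ := by
  rw [l1_smul]; exact ENNReal.mul_ne_top enorm_ne_top hA

theorem l1_sub_ne_top {A B : ℝ⟦X⟧} (hA : l1 A ≠ ∞) (hB : l1 B ≠ ∞) : l1 (A - B) ≠ ∞ :=
  ne_top_of_le_ne_top (ENNReal.add_ne_top.2 ⟨hA, hB⟩) (l1_sub_le A B)

theorem ev_pow {A : ℝ⟦X⟧} (hA : l1 A ≠ ∞) {z : ℝ} (hz : |z| ≤ 1) (k : ℕ) :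
    ev z (A ^ k) = ev z A ^ k := by
  induction k with
  | zero => simp [ev_one]
  | succ k ih => rw [pow_succ, pow_succ, ev_mul (l1_pow_ne_top hA k) hA hz, ih]

theorem l1_eq_ofReal_ev_one {A : ℝ⟦X⟧} (hA : l1 A ≠ ∞) (h0 : ∀ n, 0 ≤ coeff n A) :
    l1 A = ENNReal.ofReal (ev 1 A) := by
  rw [l1, ev, ENNReal.ofReal_tsum_of_nonneg (by simpa using h0)
    (summable_coeff_mul_pow hA (by simp))]
  exact tsum_congr fun n => by rw [Real.enorm_of_nonneg (h0 n)]; simp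

theorem continuousOn_ev {A : ℝ⟦X⟧} (hA : l1 A ≠ ∞) :
    ContinuousOn (fun z => ev z A) (Icc (-1) 1) := by
  refine continuousOn_tsum (fun n => by fun_prop) (summable_abs_coeff hA) fun n z hz => ?_
  rw [Real.norm_eq_abs, abs_mul, abs_pow]
  exact mul_le_of_le_one_right (abs_nonneg _) (pow_le_one₀ (abs_nonneg _) (abs_le.2 hz))

theorem hasFPowerSeriesAt_ev {A : ℝ⟦X⟧} (hA : l1 A ≠ ∞) :
    HasFPowerSeriesAt (fun z => ev z A) (FormalMultilinearSeries.ofScalars ℝ fun n => coeff n A)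
      0 := by
  have hr : (1 : ℝ≥0∞) ≤ (FormalMultilinearSeries.ofScalars ℝ fun n => coeff n A).radius := by
    refine FormalMultilinearSeries.le_radius_of_summable_norm _ ?_
    simpa [FormalMultilinearSeries.ofScalars_norm] using summable_abs_coeff hA
  refine ⟨1, hr, zero_lt_one, fun {y} hy => ?_⟩
  have hy' : |y| ≤ 1 := by
    have : ‖y‖ₑ < 1 := by simpa using hy
    rw [← Real.norm_eq_abs, ← ofReal_norm, ← ENNReal.ofReal_one] at *
    exact ((ENNReal.ofReal_lt_ofReal_iff zero_lt_one).1 this).le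
  simpa [FormalMultilinearSeries.ofScalars_apply_eq, ev, mul_comm] using
    (summable_coeff_mul_pow hA hy').hasSum

/-- The identity theorem: the difference is analytic at `0` and its zeros accumulate there from the
right. Analytic identities on `(0, 1)` thereby become identities of coefficients. -/
theorem ext_of_ev {A B : ℝ⟦X⟧} (hA : l1 A ≠ ∞) (hB : l1 B ≠ ∞)
    (h : ∀ z ∈ Ioo (0 : ℝ) 1, ev z A = ev z B) : A = B := by
  have h1 := (hasFPowerSeriesAt_ev hA).sub (hasFPowerSeriesAt_ev hB)
  have hev : ∀ᶠ z in 𝓝 (0 : ℝ), ev z A = ev z B := by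
    have := h1.analyticAt.frequently_zero_iff_eventually_zero.1 (by
      have : ∀ᶠ z in 𝓝[>] (0 : ℝ), ev z A = ev z B := by
        filter_upwards [Ioo_mem_nhdsGT (zero_lt_one' ℝ)] with z hz using h z hz
      refine (this.frequently.filter_mono (nhdsWithin_mono _ fun z hz => ?_)).mono ?_
      · exact ne_of_gt hz
      · intro z hz; simp [hz])
    filter_upwards [this] with z hz
    simpa [sub_eq_zero] using hz
  have h2 := ((hasFPowerSeriesAt_ev hA).congr hev).eq_formalMultilinearSeries
    (hasFPowerSeriesAt_ev hB)
  rw [FormalMultilinearSeries.ofScalars_series_eq_iff] at h2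
  ext n
  exact congrFun h2 n

/-! ### The exponential of an absolutely summable power series -/

/-- The exponential `∑ₖ Lᵏ / k!`, formed coefficientwise. -/
def expS (L : ℝ⟦X⟧) : ℝ⟦X⟧ := mk fun n => ∑' k : ℕ, coeff n (L ^ k) / k.factorial

theorem coeff_expS (L : ℝ⟦X⟧) (n : ℕ) :
    coeff n (expS L) = ∑' k : ℕ, coeff n (L ^ k) / k.factorial := coeff_mk _ _

theorem tsum_l1_pow_div_factorial_ne_top {L : ℝ⟦X⟧} (hL : l1 L ≠ ∞) :
    ∑' k : ℕ, ∑' n : ℕ, ‖coeff n (L ^ k) / k.factorial‖ₑ ≠ ∞ := by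
  have hs := Real.summable_pow_div_factorial (l1 L).toReal
  refine ne_top_of_le_ne_top hs.tsum_ofReal_ne_top (ENNReal.tsum_le_tsum fun k => ?_)
  calc ∑' n : ℕ, ‖coeff n (L ^ k) / k.factorial‖ₑ
      = l1 (((k.factorial : ℝ)⁻¹) • L ^ k) := by
        rw [l1]
        refine tsum_congr fun n => ?_
        rw [coeff_smul, smul_eq_mul, div_eq_inv_mul]
    _ ≤ ‖((k.factorial : ℝ)⁻¹)‖ₑ * l1 L ^ k := by
        rw [l1_smul]; gcongr; exact l1_pow_le L k
    _ = ENNReal.ofReal ((l1 L).toReal ^ k / k.factorial) := by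
        rw [div_eq_inv_mul, ENNReal.ofReal_mul (by positivity), ENNReal.ofReal_pow (by positivity),
          ENNReal.ofReal_toReal hL, Real.enorm_of_nonneg (by positivity)]

theorem summable_coeff_pow_div_factorial {L : ℝ⟦X⟧} (hL : l1 L ≠ ∞) {z : ℝ} (hz : |z| ≤ 1) :
    Summable fun p : ℕ × ℕ => coeff p.2 (L ^ p.1) / p.1.factorial * z ^ p.2 := by
  have h := tsum_l1_pow_div_factorial_ne_top hL
  rw [← ENNReal.tsum_prod (f := fun k n : ℕ => ‖coeff n (L ^ k) / k.factorial‖ₑ)] at h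
  have h2 : Summable fun p : ℕ × ℕ => ‖coeff p.2 (L ^ p.1) / p.1.factorial‖ := by
    simpa only [toReal_enorm] using ENNReal.summable_toReal h
  refine h2.of_norm_bounded fun p => ?_
  rw [norm_mul, norm_pow]
  exact mul_le_of_le_one_right (norm_nonneg _) (pow_le_one₀ (norm_nonneg _) hz)

theorem summable_coeff_pow_div_factorial_left {L : ℝ⟦X⟧} (hL : l1 L ≠ ∞) (n : ℕ) :
    Summable fun k : ℕ => coeff n (L ^ k) / k.factorial := by
  have := (summable_coeff_pow_div_factorial hL (z := 1) (by simp)).prod_symm.prod_factor n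
  simpa using this

theorem l1_expS_ne_top {L : ℝ⟦X⟧} (hL : l1 L ≠ ∞) : l1 (expS L) ≠ ∞ := by
  refine ne_top_of_le_ne_top (tsum_l1_pow_div_factorial_ne_top hL) ?_
  rw [ENNReal.tsum_comm]
  refine ENNReal.tsum_le_tsum fun n => ?_
  rw [coeff_expS]
  exact enorm_tsum_le_tsum_enorm

theorem ev_expS {L : ℝ⟦X⟧} (hL : l1 L ≠ ∞) {z : ℝ} (hz : |z| ≤ 1) :
    ev z (expS L) = Real.exp (ev z L) := by
  have hs := summable_coeff_pow_div_factorial hL hz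
  rw [Real.exp_eq_exp_ℝ, NormedSpace.exp_eq_tsum_div, ev]
  calc ∑' n, coeff n (expS L) * z ^ n
      = ∑' n, ∑' k : ℕ, coeff n (L ^ k) / k.factorial * z ^ n :=
        tsum_congr fun n => by rw [coeff_expS, tsum_mul_right]
    _ = ∑' k : ℕ, ∑' n, coeff n (L ^ k) / k.factorial * z ^ n :=
        Summable.tsum_comm (f := fun k n : ℕ => coeff n (L ^ k) / k.factorial * z ^ n) hs
    _ = ∑' k : ℕ, ev z L ^ k / k.factorial := by
        refine tsum_congr fun k => ?_
        rw [← ev_pow hL hz, ev, ← tsum_div_const]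
        exact tsum_congr fun n => by ring

theorem coeff_expS_nonneg {L : ℝ⟦X⟧} (h0 : ∀ n, 0 ≤ coeff n L) (n : ℕ) :
    0 ≤ coeff n (expS L) := by
  rw [coeff_expS]
  have h : ∀ k n, 0 ≤ coeff n (L ^ k) := by
    intro k
    induction k with
    | zero => intro n; rw [pow_zero, coeff_one]; split_ifs <;> norm_num
    | succ k ih =>
      intro n
      rw [pow_succ, coeff_mul]
      exact Finset.sum_nonneg fun p _ => mul_nonneg (ih _) (h0 _)
  exact tsum_nonneg fun k => div_nonneg (h k n) (by positivity)

theorem coeff_pow_succ_mul_succ (L : ℝ⟦X⟧) (k n : ℕ) :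
    coeff (n + 1) (L ^ (k + 1)) * ((n : ℝ) + 1) = (k + 1) * coeff n (d⁄dX ℝ L * L ^ k) := by
  have h : d⁄dX ℝ (L ^ (k + 1)) = C ((k : ℝ) + 1) * (d⁄dX ℝ L * L ^ k) := by
    rw [derivative_pow, Nat.add_sub_cancel, map_add, map_one, map_natCast]
    push_cast
    ring
  rw [← coeff_derivative, h, coeff_C_mul]

theorem tsum_sum_antidiagonal_coeff {L : ℝ⟦X⟧} (hL : l1 L ≠ ∞) (A : ℝ⟦X⟧) (n : ℕ) :
    ∑' k : ℕ, ∑ p ∈ Finset.HasAntidiagonal.antidiagonal n,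
        coeff p.1 A * (coeff p.2 (L ^ k) / k.factorial) = coeff n (A * expS L) := by
  have hs := summable_coeff_pow_div_factorial_left hL
  have h : ∀ p : ℕ × ℕ, HasSum (fun k : ℕ => coeff p.1 A * (coeff p.2 (L ^ k) / k.factorial))
      (coeff p.1 A * coeff p.2 (expS L)) := by
    intro p
    rw [coeff_expS]
    exact (hs p.2).hasSum.mul_left (coeff p.1 A)
  rw [coeff_mul]
  exact (hasSum_sum fun p _ => h p).tsum_eq

/-- The constant term of `L` may be nonzero, so each coefficient of `expS L` is an infinite series
in `k`. Termwise differentiation drops `k = 0`, and the shift of `k` turns `(k + 1)/(k + 1)!` into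
`1/k!`. -/
theorem derivative_expS {L : ℝ⟦X⟧} (hL : l1 L ≠ ∞) :
    d⁄dX ℝ (expS L) = d⁄dX ℝ L * expS L := by
  ext n
  have hs := (summable_coeff_pow_div_factorial_left hL (n + 1)).mul_right ((n : ℝ) + 1)
  have h0 : coeff (n + 1) (L ^ 0) / (Nat.factorial 0) * ((n : ℝ) + 1) = 0 := by
    rw [pow_zero, coeff_one, if_neg (Nat.succ_ne_zero n), zero_div, zero_mul]
  rw [coeff_derivative, coeff_expS, ← tsum_mul_right, hs.tsum_eq_zero_add, h0, zero_add,
    ← tsum_sum_antidiagonal_coeff hL]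
  refine tsum_congr fun k => ?_
  rw [div_mul_eq_mul_div, coeff_pow_succ_mul_succ, coeff_mul, Nat.factorial_succ, Nat.cast_mul,
    Nat.cast_succ, mul_div_mul_left _ _ (by positivity), Finset.sum_div]
  exact Finset.sum_congr rfl fun p _ => mul_div_assoc _ _ _

theorem expS_mul_expS_neg {L : ℝ⟦X⟧} (hL : l1 L ≠ ∞) : expS L * expS (-L) = 1 := by
  have hL' : l1 (-L) ≠ ∞ := by rwa [l1_neg]
  refine ext_of_ev (l1_mul_ne_top (l1_expS_ne_top hL) (l1_expS_ne_top hL')) (by simp [l1_one])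
    fun z hz => ?_
  have hz : |z| ≤ 1 := abs_le.2 ⟨by linarith [hz.1], hz.2.le⟩
  rw [ev_mul (l1_expS_ne_top hL) (l1_expS_ne_top hL') hz, ev_expS hL hz, ev_expS hL' hz, ev_neg,
    ev_one, ← Real.exp_add, add_neg_cancel, Real.exp_zero]

/-- Solutions of the homogeneous equation `A' = L' A` are multiples of `expS L`. -/
theorem eq_smul_expS_of_derivative {L A : ℝ⟦X⟧} (hL : l1 L ≠ ∞)
    (hA : d⁄dX ℝ A = d⁄dX ℝ L * A) : ∃ c : ℝ, A = c • expS L := by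
  have hL' : l1 (-L) ≠ ∞ := by rwa [l1_neg]
  -- Integrating factor: this product has zero derivative.
  have h : A * expS (-L) = C (constantCoeff (A * expS (-L))) := by
    refine derivative.ext ?_ (by simp)
    rw [derivative_C, Derivation.leibniz, derivative_expS hL', hA, map_neg]
    simp only [smul_eq_mul]
    ring
  refine ⟨constantCoeff (A * expS (-L)), ?_⟩
  rw [smul_eq_C_mul, ← h, mul_assoc, mul_comm (expS (-L)), expS_mul_expS_neg hL, mul_one]

/-! ### Solutions of the Stein equation in dual form -/

/-- The formal antiderivative of `Xᵐ B`, vanishing at `0`. -/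
def antideriv (m : ℕ) (B : ℝ⟦X⟧) : ℝ⟦X⟧ :=
  mk fun n => if m + 1 ≤ n then coeff (n - (m + 1)) B / n else 0

theorem coeff_antideriv_add (m : ℕ) (B : ℝ⟦X⟧) (k : ℕ) :
    coeff (k + (m + 1)) (antideriv m B) = coeff k B / (k + m + 1) := by
  rw [antideriv, coeff_mk, if_pos (by omega), Nat.add_sub_cancel]
  push_cast
  rw [add_assoc]

theorem coeff_antideriv_of_lt {m n : ℕ} (h : n < m + 1) (B : ℝ⟦X⟧) :
    coeff n (antideriv m B) = 0 := by
  rw [antideriv, coeff_mk, if_neg (by omega)]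

theorem derivative_antideriv (m : ℕ) (B : ℝ⟦X⟧) : d⁄dX ℝ (antideriv m B) = X ^ m * B := by
  ext n
  rw [coeff_derivative, coeff_X_pow_mul', antideriv, coeff_mk]
  by_cases h : m ≤ n
  · rw [if_pos (by omega), if_pos h, Nat.add_sub_add_right]
    push_cast
    field_simp
  · rw [if_neg (by omega), if_neg h, zero_mul]

theorem l1_antideriv_ne_top (m : ℕ) {B : ℝ⟦X⟧} (hB : l1 B ≠ ∞) : l1 (antideriv m B) ≠ ∞ := by
  refine l1_ne_top_of_summable ((summable_nat_add_iff (m + 1)).1 ?_)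
  refine (summable_abs_coeff hB).of_nonneg_of_le (fun n => abs_nonneg _) fun k => ?_
  rw [coeff_antideriv_add, abs_div]
  refine div_le_self (abs_nonneg _) ?_
  rw [abs_of_nonneg (by positivity)]
  have : (0 : ℝ) ≤ k + m := by positivity
  linarith

theorem ev_antideriv (m : ℕ) {B : ℝ⟦X⟧} (hB : l1 B ≠ ∞) {z : ℝ} (hz0 : 0 ≤ z) (hz : z ≤ 1) :
    ev z (antideriv m B) = ∫ s in 0..z, s ^ m * ev s B := by
  have hz' : |z| ≤ 1 := abs_le.2 ⟨by linarith, hz⟩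
  have h := intervalIntegral.hasSum_integral_of_dominated_convergence (μ := volume) (a := 0)
    (b := z) (F := fun k s => s ^ m * (coeff k B * s ^ k)) (f := fun s => s ^ m * ev s B)
    (fun k _ => |coeff k B|)
    (fun k => by
      have : Continuous fun s : ℝ => s ^ m * (coeff k B * s ^ k) := by fun_prop
      exact this.aestronglyMeasurable)
    (fun k => by
      refine ae_of_all _ fun s hs => ?_
      rw [Set.uIoc_of_le hz0] at hs
      have hs1 : |s| ≤ 1 := abs_le.2 ⟨by linarith [hs.1], hs.2.trans hz⟩
      rw [Real.norm_eq_abs, mul_left_comm, ← pow_add, abs_mul, abs_pow]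
      exact mul_le_of_le_one_right (abs_nonneg _) (pow_le_one₀ (abs_nonneg _) hs1))
    (ae_of_all _ fun s _ => summable_abs_coeff hB)
    (by simp)
    (by
      refine ae_of_all _ fun s hs => ?_
      rw [Set.uIoc_of_le hz0] at hs
      have hs1 : |s| ≤ 1 := abs_le.2 ⟨by linarith [hs.1], hs.2.trans hz⟩
      exact (summable_coeff_mul_pow hB hs1).hasSum.mul_left _)
  rw [← h.tsum_eq, ev, ← (summable_coeff_mul_pow (l1_antideriv_ne_top m hB) hz').sum_add_tsum_nat_add
    (m + 1), Finset.sum_eq_zero fun n hn => by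
      rw [coeff_antideriv_of_lt (Finset.mem_range.1 hn), zero_mul], zero_add]
  refine tsum_congr fun k => ?_
  rw [coeff_antideriv_add]
  simp_rw [mul_left_comm _ (coeff k B), ← pow_add]
  rw [intervalIntegral.integral_const_mul, integral_pow, zero_pow (by omega)]
  push_cast
  rw [show m + k + 1 = k + (m + 1) by ring, show (k : ℝ) + m + 1 = m + k + 1 by ring]
  ring

/-- The solution, of total mass `0`, of `A' = L' A - Xᵐ`. -/
def steinSol (L : ℝ⟦X⟧) (m : ℕ) : ℝ⟦X⟧ :=
  ev 1 (antideriv m (expS (-L))) • expS L - expS L * antideriv m (expS (-L))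

section steinSol
variable {L : ℝ⟦X⟧} (hL : l1 L ≠ ∞) (m : ℕ)
include hL

theorem l1_antideriv_expS_neg_ne_top : l1 (antideriv m (expS (-L))) ≠ ∞ :=
  l1_antideriv_ne_top m (l1_expS_ne_top (by rwa [l1_neg]))

theorem l1_steinSol_ne_top : l1 (steinSol L m) ≠ ∞ :=
  l1_sub_ne_top (l1_smul_ne_top _ (l1_expS_ne_top hL))
    (l1_mul_ne_top (l1_expS_ne_top hL) (l1_antideriv_expS_neg_ne_top hL m))

/-- Variation of constants: `X ^ m` equals `expS L` times the derivative of the antiderivative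
factor. -/
theorem derivative_expS_mul_antideriv :
    d⁄dX ℝ (expS L * antideriv m (expS (-L))) =
      d⁄dX ℝ L * (expS L * antideriv m (expS (-L))) + X ^ m := by
  have h : X ^ m = expS L * (X ^ m * expS (-L)) := by
    rw [mul_left_comm, expS_mul_expS_neg hL, mul_one]
  rw [Derivation.leibniz, derivative_expS hL, derivative_antideriv, smul_eq_mul, smul_eq_mul, ← h]
  ring

theorem derivative_steinSol :
    d⁄dX ℝ (steinSol L m) = d⁄dX ℝ L * steinSol L m - X ^ m := by
  rw [steinSol, map_sub, derivative_expS_mul_antideriv hL, Derivation.map_smul,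
    derivative_expS hL, mul_sub, mul_smul_comm]
  ring

theorem ev_steinSol {z : ℝ} (hz0 : 0 ≤ z) (hz : z ≤ 1) :
    ev z (steinSol L m) =
      Real.exp (ev z L) * ∫ s in z..1, s ^ m * Real.exp (-ev s L) := by
  have hz' : |z| ≤ 1 := abs_le.2 ⟨by linarith, hz⟩
  have hL' : l1 (-L) ≠ ∞ := by rwa [l1_neg]
  have hΓ := l1_antideriv_expS_neg_ne_top hL m
  have hE := l1_expS_ne_top hL
  have hint : ∀ a b : ℝ, a ∈ Icc (-1) 1 → b ∈ Icc (-1) 1 →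
      IntervalIntegrable (fun s => s ^ m * ev s (expS (-L))) volume a b := by
    intro a b ha hb
    refine (ContinuousOn.mono ?_ (Set.uIcc_subset_Icc ha hb)).intervalIntegrable
    exact (continuousOn_pow m).mul (continuousOn_ev (l1_expS_ne_top hL'))
  have h0 : (0 : ℝ) ∈ Icc (-1) 1 := by norm_num
  have h1 : (1 : ℝ) ∈ Icc (-1) 1 := by norm_num
  rw [steinSol, ev_sub (l1_smul_ne_top _ hE) (l1_mul_ne_top hE hΓ) hz', ev_smul,
    ev_mul hE hΓ hz', mul_comm, ← mul_sub, ev_expS hL hz',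
    ev_antideriv m (l1_expS_ne_top hL') hz0 hz,
    ev_antideriv m (l1_expS_ne_top hL') zero_le_one le_rfl,
    intervalIntegral.integral_interval_sub_left (hint 0 1 h0 h1) (hint 0 z h0 (abs_le.1 hz'))]
  congr 1
  refine intervalIntegral.integral_congr fun s hs => ?_
  rw [Set.uIcc_of_le hz] at hs
  rw [ev_expS hL' (abs_le.2 ⟨by linarith [hs.1], hs.2⟩), ev_neg]

theorem ev_one_steinSol : ev 1 (steinSol L m) = 0 := by
  rw [ev_steinSol hL m zero_le_one le_rfl, intervalIntegral.integral_same, mul_zero]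

/-- The factor with `expS (-L)` has signed coefficients, but the product `E` solves `E' = L' E + X ^
m` with `E(0) = 0`, a recursion with only nonnegative terms. -/
theorem coeff_expS_mul_antideriv_nonneg (h0 : ∀ n, 0 ≤ coeff n L) (n : ℕ) :
    0 ≤ coeff n (expS L * antideriv m (expS (-L))) := by
  induction n using Nat.strong_induction_on with
  | _ n ih =>
    cases n with
    | zero =>
      rw [coeff_zero_eq_constantCoeff, map_mul, ← coeff_zero_eq_constantCoeff_apply,
        ← coeff_zero_eq_constantCoeff_apply, coeff_antideriv_of_lt (Nat.succ_pos m), mul_zero]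
    | succ n =>
      have h := congrArg (coeff n) (derivative_expS_mul_antideriv hL m)
      rw [coeff_derivative, map_add, coeff_mul n] at h
      have hn : (0 : ℝ) < n + 1 := by positivity
      refine nonneg_of_mul_nonneg_left (h.symm ▸ add_nonneg (Finset.sum_nonneg fun p hp => ?_) ?_) hn
      · have := Finset.HasAntidiagonal.mem_antidiagonal.1 hp
        rw [coeff_derivative]
        exact mul_nonneg (mul_nonneg (h0 _) (by positivity)) (ih _ (by omega))
      · rw [coeff_X_pow]; split_ifs <;> norm_num

/-- Both terms of `steinSol` have nonnegative coefficients, so their norms are their values at `1`.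
These coincide, whence the factor `2`. -/
theorem l1_steinSol_le (h0 : ∀ n, 0 ≤ coeff n L) :
    l1 (steinSol L m) ≤
      ENNReal.ofReal (2 * (Real.exp (ev 1 L) * ∫ s in 0..1, s ^ m * Real.exp (-ev s L))) := by
  have hL' : l1 (-L) ≠ ∞ := by rwa [l1_neg]
  have hΓ := l1_antideriv_expS_neg_ne_top hL m
  have hE := l1_expS_ne_top hL
  have hS : ev 1 (antideriv m (expS (-L))) = ∫ s in 0..1, s ^ m * Real.exp (-ev s L) := by
    rw [ev_antideriv m (l1_expS_ne_top hL') zero_le_one le_rfl]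
    refine intervalIntegral.integral_congr fun s hs => ?_
    rw [Set.uIcc_of_le zero_le_one] at hs
    rw [ev_expS hL' (abs_le.2 ⟨by linarith [hs.1], hs.2⟩), ev_neg]
  have hS0 : 0 ≤ ∫ s in (0 : ℝ)..1, s ^ m * Real.exp (-ev s L) :=
    intervalIntegral.integral_nonneg zero_le_one fun s hs =>
      mul_nonneg (pow_nonneg hs.1 _) (Real.exp_pos _).le
  refine (l1_sub_le _ _).trans (le_of_eq ?_)
  rw [l1_smul, l1_eq_ofReal_ev_one hE (coeff_expS_nonneg h0),
    l1_eq_ofReal_ev_one (l1_mul_ne_top hE hΓ) (coeff_expS_mul_antideriv_nonneg hL m h0),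
    ev_mul hE hΓ (by simp), hS, Real.enorm_of_nonneg hS0, ← ENNReal.ofReal_mul hS0,
    ev_expS hL (by simp), ← ENNReal.ofReal_add (by positivity) (by positivity)]
  congr 1
  ring

end steinSol

theorem coeff_one_mul_le_ev {L : ℝ⟦X⟧} (hL : l1 L ≠ ∞) (h0 : ∀ n, 0 ≤ coeff n L) {s : ℝ}
    (hs : s ∈ Icc (0 : ℝ) 1) : coeff 1 L * s ≤ ev s L := by
  have h := (summable_coeff_mul_pow hL (z := s) (abs_le.2 ⟨by linarith [hs.1], hs.2⟩)).le_tsum 1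
    fun n _ => mul_nonneg (h0 n) (pow_nonneg hs.1 n)
  simpa [ev] using h

/-- Only the linear term of `L` is kept: the integrand is at most `exp(-L₁ s)`, with `L₁ = coeff 1
L`. -/
theorem integral_pow_mul_exp_neg_ev_le {L : ℝ⟦X⟧} (hL : l1 L ≠ ∞) (h0 : ∀ n, 0 ≤ coeff n L)
    (m : ℕ) :
    (∫ s in (0 : ℝ)..1, s ^ m * Real.exp (-ev s L)) ≤ 1 ∧
      (0 < coeff 1 L → (∫ s in (0 : ℝ)..1, s ^ m * Real.exp (-ev s L)) ≤ (coeff 1 L)⁻¹) := by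
  have hle : (∫ s in (0 : ℝ)..1, s ^ m * Real.exp (-ev s L)) ≤
      ∫ s in (0 : ℝ)..1, Real.exp (-(coeff 1 L * s)) := by
    refine intervalIntegral.integral_mono_on zero_le_one ?_ ?_ fun s hs => ?_
    · refine ContinuousOn.intervalIntegrable ?_
      rw [Set.uIcc_of_le zero_le_one]
      exact (continuousOn_pow m).mul (((continuousOn_ev hL).mono
        (Set.Icc_subset_Icc (by norm_num) le_rfl)).neg.rexp)
    · exact Continuous.intervalIntegrable (by fun_prop) _ _
    · have h1 := pow_le_one₀ (n := m) hs.1 hs.2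
      have h2 := coeff_one_mul_le_ev hL h0 hs
      calc s ^ m * Real.exp (-ev s L) ≤ 1 * Real.exp (-(coeff 1 L * s)) := by gcongr
        _ = _ := one_mul _
  refine ⟨hle.trans ?_, fun h1 => hle.trans ?_⟩
  · refine (intervalIntegral.integral_mono_on (g := fun _ => 1) zero_le_one
      (Continuous.intervalIntegrable (by fun_prop) _ _) (by simp) fun s hs => ?_).trans (by simp)
    exact Real.exp_le_one_iff.2 (neg_nonpos.2 (mul_nonneg (h0 1) hs.1))
  · have h : ∫ s in (0 : ℝ)..1, Real.exp (-(coeff 1 L * s)) =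
        (1 - Real.exp (-coeff 1 L)) * (coeff 1 L)⁻¹ := by
      have := intervalIntegral.integral_comp_mul_left (a := 0) (b := 1) (fun x => Real.exp x)
        (neg_ne_zero.2 h1.ne')
      simp only [neg_mul, mul_zero, mul_one, smul_eq_mul, integral_exp, Real.exp_zero] at this
      rw [this, inv_neg]
      ring
    rw [h]
    exact mul_le_of_le_one_left (inv_nonneg.2 h1.le) (by linarith [Real.exp_pos (-coeff 1 L)])

/-- A power series of total mass `1` is as close to the normalized `expS L` as it is to solving
the equation `A' = L' A`, up to the largest `ℓ¹` norm of the `steinSol L m`. -/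
theorem l1_sub_smul_expS_le {L P A : ℝ⟦X⟧} (hL : l1 L ≠ ∞) (hP : l1 P ≠ ∞) (hP1 : ev 1 P = 1)
    (hA : d⁄dX ℝ P = d⁄dX ℝ L * P - A) (hA1 : l1 A ≠ ∞) {K : ℝ≥0∞} (hK : K ≠ ∞)
    (hD : ∀ m, l1 (steinSol L m) ≤ K) :
    l1 (P - Real.exp (-ev 1 L) • expS L) ≤ K * l1 A := by
  have hfin : ∑' m, ∑' n, ‖coeff m A * coeff n (steinSol L m)‖ₑ ≤ K * l1 A := by
    rw [mul_comm, l1, ← ENNReal.tsum_mul_right]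
    refine ENNReal.tsum_le_tsum fun m => ?_
    simp_rw [enorm_mul]
    rw [ENNReal.tsum_mul_left]
    gcongr
    exact hD m
  have hs : Summable fun p : ℕ × ℕ => coeff p.1 A * coeff p.2 (steinSol L p.1) := by
    have h := ne_top_of_le_ne_top (ENNReal.mul_ne_top hK hA1) hfin
    rw [← ENNReal.tsum_prod (f := fun m n : ℕ => ‖coeff m A * coeff n (steinSol L m)‖ₑ)] at h
    refine Summable.of_norm ?_
    simpa only [toReal_enorm] using ENNReal.summable_toReal h
  -- By linearity `W` inherits mass `0` and the inhomogeneous equation with right-hand side `-A`.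
  set W : ℝ⟦X⟧ := mk fun n => ∑' m, coeff m A * coeff n (steinSol L m) with hW
  have hsum : ∀ n, HasSum (fun m => coeff m A * coeff n (steinSol L m)) (coeff n W) := by
    intro n
    rw [hW, coeff_mk]
    exact (hs.prod_symm.prod_factor n).hasSum
  have hWl : l1 W ≤ K * l1 A := by
    refine le_trans ?_ hfin
    rw [ENNReal.tsum_comm]
    refine ENNReal.tsum_le_tsum fun n => ?_
    rw [← (hsum n).tsum_eq]
    exact enorm_tsum_le_tsum_enorm
  have hWt : l1 W ≠ ∞ := ne_top_of_le_ne_top (ENNReal.mul_ne_top hK hA1) hWl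
  have hW1 : ev 1 W = 0 := by
    calc ev 1 W = ∑' n, ∑' m, coeff m A * coeff n (steinSol L m) :=
          tsum_congr fun n => by rw [one_pow, mul_one, (hsum n).tsum_eq]
      _ = ∑' m, ∑' n, coeff m A * coeff n (steinSol L m) :=
          Summable.tsum_comm (f := fun m n : ℕ => coeff m A * coeff n (steinSol L m)) hs
      _ = ∑' m, coeff m A * ev 1 (steinSol L m) := by
          refine tsum_congr fun m => ?_
          rw [tsum_mul_left, ev]
          simp
      _ = 0 := by simp [ev_one_steinSol hL]
  have hWd : d⁄dX ℝ W = d⁄dX ℝ L * W - A := by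
    ext n
    rw [coeff_derivative, map_sub, coeff_mul]
    have h1 := (hsum (n + 1)).mul_right ((n : ℝ) + 1)
    have h2 : HasSum (fun m => (∑ p ∈ Finset.HasAntidiagonal.antidiagonal n,
        coeff p.1 (d⁄dX ℝ L) * (coeff m A * coeff p.2 (steinSol L m))) -
          coeff m A * coeff n ((X : ℝ⟦X⟧) ^ m))
        ((∑ p ∈ Finset.HasAntidiagonal.antidiagonal n,
          coeff p.1 (d⁄dX ℝ L) * coeff p.2 W) - coeff n A) := by
      refine (hasSum_sum fun p _ => (hsum p.2).mul_left (coeff p.1 (d⁄dX ℝ L))).sub ?_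
      refine (hasSum_ite_eq n (coeff n A)).congr_fun fun m => ?_
      rw [coeff_X_pow]
      by_cases h : m = n
      · simp [h]
      · rw [if_neg h, if_neg (Ne.symm h), mul_zero]
    refine h1.unique (h2.congr_fun fun m => ?_)
    have h3 := congrArg (coeff n) (derivative_steinSol hL m)
    rw [coeff_derivative, map_sub, coeff_mul] at h3
    rw [mul_assoc, h3, mul_sub, Finset.mul_sum]
    congr 1
    exact Finset.sum_congr rfl fun p _ => by ring
  -- The defects of `P` and `W` cancel; comparing masses at `1` then fixes `c`.
  obtain ⟨c, hc⟩ := eq_smul_expS_of_derivative (A := P - W) hL (by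
    rw [map_sub, hA, hWd]; ring)
  have h1 := congrArg (ev 1) hc
  rw [ev_sub hP hWt (by simp), hP1, hW1, ev_smul, ev_expS hL (by simp), sub_zero] at h1
  have hc' : c = Real.exp (-ev 1 L) := by
    rw [Real.exp_neg]; exact eq_inv_of_mul_eq_one_left h1.symm
  rw [← hc', ← hc, sub_sub_cancel]
  exact hWl

/-! ### Coefficients of exponentials, continued -/

theorem coeff_zero_expS {L : ℝ⟦X⟧} (hL : l1 L ≠ ∞) :
    coeff 0 (expS L) = Real.exp (coeff 0 L) := by
  have h : ∀ A : ℝ⟦X⟧, ev 0 A = coeff 0 A := fun A => by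
    rw [ev, tsum_eq_single 0 fun n hn => by simp [hn]]; simp
  rw [← h, ← h, ev_expS hL (by simp)]

theorem coeff_succ_expS {L : ℝ⟦X⟧} (hL : l1 L ≠ ∞) (n : ℕ) :
    coeff (n + 1) (expS L) = (∑ p ∈ Finset.HasAntidiagonal.antidiagonal n,
      coeff (p.1 + 1) L * (p.1 + 1) * coeff p.2 (expS L)) / (n + 1) := by
  have h := congrArg (coeff n) (derivative_expS hL)
  rw [coeff_derivative, coeff_mul] at h
  rw [eq_div_iff (by positivity), h]
  exact Finset.sum_congr rfl fun p _ => by rw [coeff_derivative]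

/-- A constant term only contributes a positive factor, so its sign is free. This matters for `a •
(X - 1)` and for `immigration`. -/
theorem coeff_expS_nonneg_of_succ {L : ℝ⟦X⟧} (hL : l1 L ≠ ∞) (h0 : ∀ n, 0 ≤ coeff (n + 1) L)
    (n : ℕ) : 0 ≤ coeff n (expS L) := by
  induction n using Nat.strong_induction_on with
  | _ n ih =>
    cases n with
    | zero => rw [coeff_zero_expS hL]; exact (Real.exp_pos _).le
    | succ n =>
      rw [coeff_succ_expS hL]
      refine div_nonneg (Finset.sum_nonneg fun p hp => ?_) (by positivity)
      have := Finset.HasAntidiagonal.mem_antidiagonal.1 hp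
      exact mul_nonneg (mul_nonneg (h0 _) (by positivity)) (ih _ (by omega))

theorem continuousOn_coeff_expS {F : ℝ → ℝ⟦X⟧} {s : Set ℝ} (hF : ∀ u ∈ s, l1 (F u) ≠ ∞)
    (hc : ∀ n, ContinuousOn (fun u => coeff n (F u)) s) (n : ℕ) :
    ContinuousOn (fun u => coeff n (expS (F u))) s := by
  induction n using Nat.strong_induction_on with
  | _ n ih =>
    cases n with
    | zero => exact (hc 0).rexp.congr fun u hu => coeff_zero_expS (hF u hu)
    | succ n =>
      refine ContinuousOn.congr ?_ fun u hu => coeff_succ_expS (hF u hu) n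
      refine ContinuousOn.div_const (continuousOn_finsetSum _ fun p hp => ?_) _
      have := Finset.HasAntidiagonal.mem_antidiagonal.1 hp
      exact ((hc _).mul continuousOn_const).mul (ih _ (by omega))

theorem continuousOn_coeff_mul {F G : ℝ → ℝ⟦X⟧} {s : Set ℝ}
    (hF : ∀ n, ContinuousOn (fun u => coeff n (F u)) s)
    (hG : ∀ n, ContinuousOn (fun u => coeff n (G u)) s) (n : ℕ) :
    ContinuousOn (fun u => coeff n (F u * G u)) s := by
  simp_rw [coeff_mul]
  exact continuousOn_finsetSum _ fun p _ => (hF _).mul (hG _)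

theorem coeff_mul_nonneg {A B : ℝ⟦X⟧} (hA : ∀ n, 0 ≤ coeff n A) (hB : ∀ n, 0 ≤ coeff n B) (n : ℕ) :
    0 ≤ coeff n (A * B) := by
  rw [coeff_mul]
  exact Finset.sum_nonneg fun p _ => mul_nonneg (hA _) (hB _)

/-! ### Poisson smoothing -/

/-- The generating series of the Poisson distribution with mean `a`. -/
def poissonSeries (a : ℝ) : ℝ⟦X⟧ := expS (a • (X - 1))

theorem l1_smul_X_sub_one_ne_top (a : ℝ) : l1 (a • (X - 1 : ℝ⟦X⟧)) ≠ ∞ :=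
  l1_smul_ne_top _ (l1_sub_ne_top (by simp [l1_X]) (by simp [l1_one]))

theorem ev_smul_X_sub_one (a : ℝ) {z : ℝ} (hz : |z| ≤ 1) :
    ev z (a • (X - 1 : ℝ⟦X⟧)) = a * (z - 1) := by
  rw [ev_smul, ev_sub (by simp [l1_X]) (by simp [l1_one]) hz, ev_X, ev_one]

theorem l1_poissonSeries_ne_top (a : ℝ) : l1 (poissonSeries a) ≠ ∞ :=
  l1_expS_ne_top (l1_smul_X_sub_one_ne_top a)

theorem ev_poissonSeries (a : ℝ) {z : ℝ} (hz : |z| ≤ 1) :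
    ev z (poissonSeries a) = Real.exp (a * (z - 1)) := by
  rw [poissonSeries, ev_expS (l1_smul_X_sub_one_ne_top a) hz, ev_smul_X_sub_one a hz]

theorem coeff_poissonSeries_nonneg {a : ℝ} (ha : 0 ≤ a) (n : ℕ) :
    0 ≤ coeff n (poissonSeries a) := by
  refine coeff_expS_nonneg_of_succ (l1_smul_X_sub_one_ne_top a) (fun n => ?_) n
  rw [coeff_smul, map_sub, coeff_X, coeff_one, if_neg (Nat.succ_ne_zero n), sub_zero]
  exact mul_nonneg ha (by split_ifs <;> norm_num)

theorem l1_poissonSeries {a : ℝ} (ha : 0 ≤ a) : l1 (poissonSeries a) = 1 := by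
  rw [l1_eq_ofReal_ev_one (l1_poissonSeries_ne_top a) (coeff_poissonSeries_nonneg ha),
    ev_poissonSeries a (by simp)]
  simp

theorem coeff_succ_poissonSeries (a : ℝ) (n : ℕ) :
    ((n : ℝ) + 1) * coeff (n + 1) (poissonSeries a) = a * coeff n (poissonSeries a) := by
  have h := congrArg (coeff n) (derivative_expS (l1_smul_X_sub_one_ne_top a))
  rw [Derivation.map_smul, map_sub, derivative_X, derivative_one, sub_zero, smul_one_mul,
    coeff_smul, coeff_derivative, mul_comm] at h
  exact h

theorem hasSum_poissonSeries (a : ℝ) : HasSum (fun n => coeff n (poissonSeries a)) 1 := by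
  have h := (summable_coeff_mul_pow (l1_poissonSeries_ne_top a) (z := 1) (by simp)).hasSum
  rw [show ∑' n, coeff n (poissonSeries a) * 1 ^ n = ev 1 (poissonSeries a) from rfl,
    ev_poissonSeries a (by simp)] at h
  simpa using h

theorem hasSum_mul_poissonSeries (a : ℝ) :
    HasSum (fun n : ℕ => n * coeff n (poissonSeries a)) a := by
  rw [← hasSum_nat_add_iff' 1]
  simpa [coeff_succ_poissonSeries] using (hasSum_poissonSeries a).mul_left a

theorem hasSum_sq_mul_poissonSeries (a : ℝ) :
    HasSum (fun n : ℕ => (n : ℝ) ^ 2 * coeff n (poissonSeries a)) (a ^ 2 + a) := by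
  rw [← hasSum_nat_add_iff' 1]
  have h := ((hasSum_mul_poissonSeries a).add (hasSum_poissonSeries a)).mul_left a
  rw [show a * (a + 1) = a ^ 2 + a - ∑ i ∈ Finset.range 1,
    (i : ℝ) ^ 2 * coeff i (poissonSeries a) by simp; ring] at h
  refine h.congr_fun fun n => ?_
  have := coeff_succ_poissonSeries a n
  push_cast
  linear_combination ((n : ℝ) + 1) * this

theorem coeff_one_sub_X_mul_poissonSeries {a : ℝ} (ha : 0 < a) (n : ℕ) :
    coeff n ((1 - X) * poissonSeries a) = coeff n (poissonSeries a) * (1 - n / a) := by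
  rw [sub_mul, one_mul, map_sub]
  cases n with
  | zero => simp
  | succ n =>
    have := coeff_succ_poissonSeries a n
    rw [coeff_succ_X_mul]
    push_cast
    field_simp
    linarith

/-- The norm is `E|1 - N/a|` for `N` Poisson of mean `a`, at most the standard deviation `a^(-1/2)`
of `N/a`. -/
theorem l1_one_sub_X_mul_poissonSeries_le {a : ℝ} (ha : 0 < a) :
    l1 ((1 - X) * poissonSeries a) ≤ ENNReal.ofReal (√a)⁻¹ := by
  have hs : 0 < √a := Real.sqrt_pos.2 ha
  have h1 := (((hasSum_poissonSeries a).sub ((hasSum_mul_poissonSeries a).mul_left (2 / a))).add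
    ((hasSum_sq_mul_poissonSeries a).mul_left (1 / a ^ 2))).mul_left (√a / 2)
  have h2 := h1.add ((hasSum_poissonSeries a).mul_left ((√a)⁻¹ / 2))
  have hval : √a / 2 * (1 - 2 / a * a + 1 / a ^ 2 * (a ^ 2 + a)) + (√a)⁻¹ / 2 * 1 = (√a)⁻¹ := by
    have : a = √a ^ 2 := (Real.sq_sqrt ha.le).symm
    field_simp
    rw [← this]
    ring
  rw [hval] at h2
  rw [← h2.tsum_eq, ENNReal.ofReal_tsum_of_nonneg _ h2.summable]
  · refine ENNReal.tsum_le_tsum fun n => ?_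
    rw [coeff_one_sub_X_mul_poissonSeries ha, Real.enorm_eq_ofReal_abs]
    refine ENNReal.ofReal_le_ofReal ?_
    have hp := coeff_poissonSeries_nonneg ha.le n
    rw [abs_mul, abs_of_nonneg hp]
    -- AM–GM with weight `√a`, chosen so that both terms have mean `(√a)⁻¹ / 2`.
    have h3 : |1 - n / a| ≤ √a / 2 * (1 - n / a) ^ 2 + (√a)⁻¹ / 2 := by
      have h4 := sq_nonneg (√a * |1 - n / a| - 1)
      rw [← sq_abs (1 - n / a)]
      generalize |1 - n / a| = t at h4 ⊢
      field_simp
      nlinarith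
    refine (mul_le_mul_of_nonneg_left h3 hp).trans (le_of_eq ?_)
    field_simp
    ring
  · intro n
    have hp := coeff_poissonSeries_nonneg ha.le n
    have h3 : 0 ≤ (√a / 2 * (1 - n / a) ^ 2 + (√a)⁻¹ / 2) * coeff n (poissonSeries a) := by
      positivity
    refine h3.trans (le_of_eq ?_)
    field_simp
    ring

/-! ### Binomial thinning -/

/-- The series of `A (u + (1 - u) X)`. -/
def thinning (A : ℝ⟦X⟧) (u : ℝ) : ℝ⟦X⟧ :=
  mk fun k => ∑' j, coeff j A * (j.choose k * u ^ (j - k) * (1 - u) ^ k)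

theorem coeff_thinning (A : ℝ⟦X⟧) (u : ℝ) (k : ℕ) :
    coeff k (thinning A u) = ∑' j, coeff j A * (j.choose k * u ^ (j - k) * (1 - u) ^ k) :=
  coeff_mk _ _

theorem hasSum_choose_mul_pow (u z : ℝ) (j : ℕ) :
    HasSum (fun k => (j.choose k * u ^ (j - k) * (1 - u) ^ k) * z ^ k) ((u + (1 - u) * z) ^ j) := by
  rw [add_comm u, add_pow]
  refine (hasSum_sum_of_ne_finset_zero (s := Finset.range (j + 1)) fun k hk => ?_).congr_fun
    fun k => by rw [mul_pow]; ring
  rw [Nat.choose_eq_zero_of_lt (by simpa using hk)]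
  simp

theorem choose_mul_pow_nonneg {u : ℝ} (hu : u ∈ Icc (0 : ℝ) 1) (j k : ℕ) :
    0 ≤ j.choose k * u ^ (j - k) * (1 - u) ^ k := by
  have h0 := hu.1
  have h1 : 0 ≤ 1 - u := by linarith [hu.2]
  positivity

theorem choose_mul_pow_le_one {u : ℝ} (hu : u ∈ Icc (0 : ℝ) 1) (j k : ℕ) :
    j.choose k * u ^ (j - k) * (1 - u) ^ k ≤ 1 := by
  have h := hasSum_choose_mul_pow u 1 j
  simp only [one_pow, mul_one, add_sub_cancel] at h
  exact le_hasSum h k fun i _ => choose_mul_pow_nonneg hu j i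

section thinning
variable {A : ℝ⟦X⟧} (hA : l1 A ≠ ∞)
include hA

theorem summable_thinning {u z : ℝ} (hu : u ∈ Icc (0 : ℝ) 1) (hz : |z| ≤ 1) :
    Summable fun p : ℕ × ℕ =>
      coeff p.1 A * (p.1.choose p.2 * u ^ (p.1 - p.2) * (1 - u) ^ p.2) * z ^ p.2 := by
  have h1 : Summable fun p : ℕ × ℕ =>
      |coeff p.1 A| * (p.1.choose p.2 * u ^ (p.1 - p.2) * (1 - u) ^ p.2) := by
    have h2 : ∀ j, HasSum (fun k : ℕ => |coeff j A| * (j.choose k * u ^ (j - k) * (1 - u) ^ k))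
        |coeff j A| := fun j => by
      simpa using (hasSum_choose_mul_pow u 1 j).mul_left |coeff j A|
    rw [summable_prod_of_nonneg fun p => mul_nonneg (abs_nonneg _) (choose_mul_pow_nonneg hu _ _)]
    exact ⟨fun j => (h2 j).summable, (summable_abs_coeff hA).congr fun j => (h2 j).tsum_eq.symm⟩
  refine h1.of_norm_bounded fun p => ?_
  rw [norm_mul, norm_mul, norm_pow, Real.norm_of_nonneg (choose_mul_pow_nonneg hu _ _)]
  refine mul_le_of_le_one_right ?_ (pow_le_one₀ (norm_nonneg _) hz)
  exact mul_nonneg (norm_nonneg _) (choose_mul_pow_nonneg hu _ _)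

theorem hasSum_coeff_thinning {u : ℝ} (hu : u ∈ Icc (0 : ℝ) 1) (k : ℕ) :
    HasSum (fun j => coeff j A * (j.choose k * u ^ (j - k) * (1 - u) ^ k))
      (coeff k (thinning A u)) := by
  rw [coeff_thinning]
  have := (summable_thinning hA hu (z := 1) (by simp)).prod_symm.prod_factor k
  simp only [Prod.swap, one_pow, mul_one] at this
  exact this.hasSum

theorem l1_thinning_ne_top {u : ℝ} (hu : u ∈ Icc (0 : ℝ) 1) : l1 (thinning A u) ≠ ∞ := by
  have h : Summable fun p : ℕ × ℕ =>
      |coeff p.2 A * (p.2.choose p.1 * u ^ (p.2 - p.1) * (1 - u) ^ p.1)| := by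
    simpa using (summable_thinning hA hu (z := 1) (by simp)).abs.prod_symm
  refine l1_ne_top_of_summable (h.prod.of_nonneg_of_le (fun k => abs_nonneg _) fun k => ?_)
  have h2 : Summable fun j : ℕ => ‖coeff j A * (j.choose k * u ^ (j - k) * (1 - u) ^ k)‖ :=
    h.prod_factor k
  rw [coeff_thinning, ← Real.norm_eq_abs]
  exact norm_tsum_le_tsum_norm h2

theorem ev_thinning {u z : ℝ} (hu : u ∈ Icc (0 : ℝ) 1) (hz : |z| ≤ 1) :
    ev z (thinning A u) = ev (u + (1 - u) * z) A := by
  calc ev z (thinning A u)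
      = ∑' k, ∑' j, coeff j A * (j.choose k * u ^ (j - k) * (1 - u) ^ k) * z ^ k :=
        tsum_congr fun k => by rw [coeff_thinning, tsum_mul_right]
    _ = ∑' j, ∑' k, coeff j A * (j.choose k * u ^ (j - k) * (1 - u) ^ k) * z ^ k :=
        Summable.tsum_comm (f := fun j k : ℕ =>
          coeff j A * (j.choose k * u ^ (j - k) * (1 - u) ^ k) * z ^ k) (summable_thinning hA hu hz)
    _ = ev (u + (1 - u) * z) A := by
        refine tsum_congr fun j => ?_
        simp_rw [mul_assoc (coeff j A)]
        rw [tsum_mul_left, (hasSum_choose_mul_pow u z j).tsum_eq]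

theorem continuousOn_coeff_thinning (k : ℕ) :
    ContinuousOn (fun u => coeff k (thinning A u)) (Icc 0 1) := by
  simp_rw [coeff_thinning]
  refine continuousOn_tsum (fun j => by fun_prop) (summable_abs_coeff hA) fun j u hu => ?_
  rw [norm_mul, Real.norm_of_nonneg (choose_mul_pow_nonneg hu _ _)]
  exact mul_le_of_le_one_right (norm_nonneg _) (choose_mul_pow_le_one hu _ _)

theorem coeff_thinning_nonneg (h0 : ∀ n, 0 ≤ coeff n A) {u : ℝ} (hu : u ∈ Icc (0 : ℝ) 1) (k : ℕ) :
    0 ≤ coeff k (thinning A u) :=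
  (hasSum_coeff_thinning hA hu k).nonneg fun j => mul_nonneg (h0 j) (choose_mul_pow_nonneg hu _ _)

/-- In positive degrees the coefficients of the thinning are averages of `j ↦ j * coeff j A`
with respect to negative binomial distributions. -/
theorem hasSum_succ_mul_coeff_thinning {u : ℝ} (hu : u ∈ Icc (0 : ℝ) 1) (k : ℕ) :
    HasSum (fun i : ℕ => ((i + k + 1 : ℕ) * coeff (i + k + 1) A) *
      ((i + k).choose k * u ^ i * (1 - u) ^ (k + 1))) ((k + 1) * coeff (k + 1) (thinning A u)) := by
  have h := hasSum_coeff_thinning hA hu (k + 1)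
  rw [← hasSum_nat_add_iff' (k + 1), Finset.sum_eq_zero fun j hj => by
    rw [Nat.choose_eq_zero_of_lt (by simpa using hj)]; simp, sub_zero] at h
  refine (h.mul_left ((k : ℝ) + 1)).congr_fun fun i => ?_
  -- Absorption `(k + 1) C(j, k + 1) = j C(j - 1, k)` with `j = i + k + 1`.
  have hc : ((i + k).succ : ℝ) * (i + k).choose k = (i + k).succ.choose k.succ * k.succ := by
    exact_mod_cast Nat.add_one_mul_choose_eq (i + k) k
  rw [← add_assoc, show i + k + 1 - (k + 1) = i by omega]
  push_cast at hc ⊢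
  linear_combination coeff (i + k + 1) A * u ^ i * (1 - u) ^ (k + 1) * hc

end thinning

theorem hasSum_negBinomial {u : ℝ} (hu : u ∈ Ico (0 : ℝ) 1) (k : ℕ) :
    HasSum (fun i : ℕ => ((i + k).choose k : ℝ) * u ^ i * (1 - u) ^ (k + 1)) 1 := by
  have h1 : 0 < 1 - u := by linarith [hu.2]
  have h := (hasSum_choose_mul_geometric_of_norm_lt_one k
    (r := u) (by rw [Real.norm_of_nonneg hu.1]; exact hu.2)).mul_right ((1 - u) ^ (k + 1))
  rwa [one_div, inv_mul_cancel₀ (by positivity)] at h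

section monotone
variable {L : ℝ⟦X⟧} (hL : l1 L ≠ ∞)
  (hmono : ∀ ⦃i j : ℕ⦄, 1 ≤ i → i ≤ j → (j : ℝ) * coeff j L ≤ i * coeff i L)
include hL hmono

/-- A negative binomial average of `j * coeff j L` over `j ≥ k + 1` is at most its first value. -/
theorem coeff_thinning_le {u : ℝ} (hu : u ∈ Ico (0 : ℝ) 1) (k : ℕ) :
    coeff (k + 1) (thinning L u) ≤ coeff (k + 1) L := by
  have hu' : u ∈ Icc (0 : ℝ) 1 := ⟨hu.1, hu.2.le⟩
  have h1 : 0 ≤ 1 - u := by linarith [hu.2]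
  have h := hasSum_le (fun i => mul_le_mul_of_nonneg_right
    (hmono (i := k + 1) (j := i + k + 1) (by omega) (by omega)) ?_)
    (hasSum_succ_mul_coeff_thinning hL hu' k)
    ((hasSum_negBinomial hu k).mul_left (((k + 1 : ℕ) : ℝ) * coeff (k + 1) L))
  · push_cast at h
    have hk : (0 : ℝ) < k + 1 := by positivity
    nlinarith
  · have := hu.1
    positivity

theorem coeff_one_thinning_le {u : ℝ} (hu : u ∈ Ico (0 : ℝ) 1) :
    coeff 1 (thinning L u) ≤ coeff 1 L - (coeff 1 L - 2 * coeff 2 L) * u := by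
  have hu' : u ∈ Icc (0 : ℝ) 1 := ⟨hu.1, hu.2.le⟩
  have h1 : 0 ≤ 1 - u := by linarith [hu.2]
  -- For `k = 0` the weights are geometric: `j = 1` is kept exactly, and every `j ≥ 2` is bounded by
  -- its value at `2`.
  have h2 := ((hasSum_negBinomial hu 0).mul_left (2 * coeff 2 L)).add
    (hasSum_ite_eq 0 ((coeff 1 L - 2 * coeff 2 L) * (1 - u)))
  have h := hasSum_le (fun i => ?_) (hasSum_succ_mul_coeff_thinning hL hu' 0) h2
  · norm_num at h
    linarith
  · cases i with
    | zero => norm_num; linarith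
    | succ i =>
      have h3 := hmono (i := 2) (j := i + 1 + 0 + 1) (by omega) (by omega)
      rw [if_neg (Nat.succ_ne_zero i), add_zero (_ * _)]
      refine mul_le_mul_of_nonneg_right (by exact_mod_cast h3) ?_
      have := hu.1
      positivity

end monotone

/-! ### Mixtures of power series -/

/-- The coefficientwise integral of a family of power series over `(0, 1)`. -/
def mixture (F : ℝ → ℝ⟦X⟧) : ℝ⟦X⟧ := mk fun n => ∫ u in Ioo (0 : ℝ) 1, coeff n (F u)

section mixture
variable {F : ℝ → ℝ⟦X⟧} (hF : ∀ n, ContinuousOn (fun u => coeff n (F u)) (Icc 0 1))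
include hF

theorem aestronglyMeasurable_coeff (n : ℕ) :
    AEStronglyMeasurable (fun u => coeff n (F u)) (volume.restrict (Ioo (0 : ℝ) 1)) :=
  ((hF n).mono Set.Ioo_subset_Icc_self).aestronglyMeasurable measurableSet_Ioo

theorem lintegral_l1_eq_tsum :
    ∫⁻ u in Ioo (0 : ℝ) 1, l1 (F u) = ∑' n, ∫⁻ u in Ioo (0 : ℝ) 1, ‖coeff n (F u)‖ₑ :=
  lintegral_tsum fun n => (aestronglyMeasurable_coeff hF n).enorm

theorem l1_mixture_le : l1 (mixture F) ≤ ∫⁻ u in Ioo (0 : ℝ) 1, l1 (F u) := by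
  rw [lintegral_l1_eq_tsum hF]
  refine ENNReal.tsum_le_tsum fun n => ?_
  rw [mixture, coeff_mk]
  exact enorm_integral_le_lintegral_enorm _

theorem ev_mixture (hfin : ∫⁻ u in Ioo (0 : ℝ) 1, l1 (F u) ≠ ∞) {z : ℝ} (hz : |z| ≤ 1) :
    ev z (mixture F) = ∫ u in Ioo (0 : ℝ) 1, ev z (F u) := by
  have h : ∫ u in Ioo (0 : ℝ) 1, ev z (F u) =
      ∑' n, ∫ u in Ioo (0 : ℝ) 1, coeff n (F u) * z ^ n := by
    refine integral_tsum (fun n => (aestronglyMeasurable_coeff hF n).mul_const _) ?_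
    refine ne_top_of_le_ne_top hfin ?_
    rw [lintegral_l1_eq_tsum hF]
    refine ENNReal.tsum_le_tsum fun n => lintegral_mono fun u => ?_
    rw [enorm_mul]
    refine mul_le_of_le_one_right zero_le ?_
    rw [Real.enorm_eq_ofReal_abs, abs_pow]
    exact ENNReal.ofReal_le_one.2 (pow_le_one₀ (abs_nonneg _) hz)
  rw [h, ev]
  refine tsum_congr fun n => ?_
  rw [mixture, coeff_mk, integral_mul_const]

end mixture

theorem lintegral_inv_sqrt_mul {a : ℝ} (ha : 0 < a) :
    ∫⁻ u in Ioo (0 : ℝ) 1, ENNReal.ofReal (√(a * u))⁻¹ = ENNReal.ofReal (2 * (√a)⁻¹) := by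
  have hfun : ∀ u ∈ Ioo (0 : ℝ) 1, (√(a * u))⁻¹ = (√a)⁻¹ * u ^ (-(1 / 2) : ℝ) := by
    intro u hu
    rw [Real.sqrt_mul ha.le, mul_inv, Real.rpow_neg hu.1.le, ← Real.sqrt_eq_rpow]
  have hint : IntegrableOn (fun u : ℝ => (√a)⁻¹ * u ^ (-(1 / 2) : ℝ)) (Ioo 0 1) := by
    have := intervalIntegral.intervalIntegrable_rpow' (a := 0) (b := 1) (r := -(1 / 2))
      (by norm_num)
    rw [intervalIntegrable_iff_integrableOn_Ioo_of_le zero_le_one] at this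
    exact this.const_mul _
  rw [setLIntegral_congr_fun measurableSet_Ioo fun u hu => congrArg ENNReal.ofReal (hfun u hu),
    ← ofReal_integral_eq_lintegral_ofReal hint]
  · congr 1
    rw [← integral_Ioc_eq_integral_Ioo, ← intervalIntegral.integral_of_le zero_le_one,
      intervalIntegral.integral_const_mul, integral_rpow (Or.inl (by norm_num))]
    norm_num
    ring
  · refine (ae_restrict_mem measurableSet_Ioo).mono fun u hu => ?_
    exact mul_nonneg (inv_nonneg.2 (Real.sqrt_nonneg _)) (Real.rpow_nonneg hu.1.le _)

/-! ### The Stein solution for monotone weights -/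

/-- The logarithm of the generating series of the batch immigrants other than those that are
accounted for by a Poisson variable with mean `a * u`. -/
def immigration (L : ℝ⟦X⟧) (a u : ℝ) : ℝ⟦X⟧ := L - thinning L u - (a * u) • (X - 1)

/-- The generating series of the immigration-death process started at `m`, at time
`-log (1 - u)`. -/
def immigrationDeath (L : ℝ⟦X⟧) (a : ℝ) (m : ℕ) (u : ℝ) : ℝ⟦X⟧ :=
  poissonSeries (a * u) * (expS (immigration L a u) * thinning (X ^ m) u)

theorem l1_X_pow_ne_top (m : ℕ) : l1 (X ^ m) ≠ ∞ := l1_pow_ne_top (by simp [l1_X]) m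

section immigrationDeath
variable {L : ℝ⟦X⟧} (hL : l1 L ≠ ∞)
include hL

section
variable {u : ℝ} (hu : u ∈ Icc (0 : ℝ) 1) (a : ℝ)
include hu

theorem l1_immigration_ne_top : l1 (immigration L a u) ≠ ∞ :=
  l1_sub_ne_top (l1_sub_ne_top hL (l1_thinning_ne_top hL hu)) (l1_smul_X_sub_one_ne_top _)

theorem ev_immigration {z : ℝ} (hz : |z| ≤ 1) :
    ev z (immigration L a u) = ev z L - ev (u + (1 - u) * z) L - a * u * (z - 1) := by
  rw [immigration, ev_sub (l1_sub_ne_top hL (l1_thinning_ne_top hL hu))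
    (l1_smul_X_sub_one_ne_top _) hz, ev_sub hL (l1_thinning_ne_top hL hu) hz,
    ev_thinning hL hu hz, ev_smul_X_sub_one _ hz]

theorem l1_immigrationDeath_right_ne_top (m : ℕ) :
    l1 (expS (immigration L a u) * thinning (X ^ m) u) ≠ ∞ :=
  l1_mul_ne_top (l1_expS_ne_top (l1_immigration_ne_top hL hu a))
    (l1_thinning_ne_top (l1_X_pow_ne_top m) hu)

theorem ev_immigrationDeath_right (m : ℕ) {z : ℝ} (hz : |z| ≤ 1) :
    ev z (expS (immigration L a u) * thinning (X ^ m) u) =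
      Real.exp (ev z L - ev (u + (1 - u) * z) L - a * u * (z - 1)) * (u + (1 - u) * z) ^ m := by
  have hz' : |u + (1 - u) * z| ≤ 1 := by
    have h1 : 0 ≤ 1 - u := by linarith [hu.2]
    rw [abs_le] at hz ⊢
    constructor <;> nlinarith [hz.1, hz.2, hu.1]
  rw [ev_mul (l1_expS_ne_top (l1_immigration_ne_top hL hu a))
    (l1_thinning_ne_top (l1_X_pow_ne_top m) hu) hz, ev_expS (l1_immigration_ne_top hL hu a) hz,
    ev_immigration hL hu a hz, ev_thinning (l1_X_pow_ne_top m) hu hz,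
    ev_pow (by simp [l1_X]) hz', ev_X]

theorem l1_immigrationDeath_ne_top (m : ℕ) : l1 (immigrationDeath L a m u) ≠ ∞ :=
  l1_mul_ne_top (l1_poissonSeries_ne_top _) (l1_immigrationDeath_right_ne_top hL hu a m)

theorem ev_immigrationDeath (m : ℕ) {z : ℝ} (hz : |z| ≤ 1) :
    ev z (immigrationDeath L a m u) =
      Real.exp (ev z L - ev (u + (1 - u) * z) L) * (u + (1 - u) * z) ^ m := by
  rw [immigrationDeath, ev_mul (l1_poissonSeries_ne_top _)
    (l1_immigrationDeath_right_ne_top hL hu a m) hz, ev_poissonSeries _ hz,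
    ev_immigrationDeath_right hL hu a m hz, ← mul_assoc, ← Real.exp_add]
  congr 2
  ring

end

theorem continuousOn_coeff_immigrationDeath (a : ℝ) (m n : ℕ) :
    ContinuousOn (fun u => coeff n (immigrationDeath L a m u)) (Icc 0 1) := by
  have hlin : ∀ n, ContinuousOn (fun u : ℝ => coeff n ((a * u) • (X - 1 : ℝ⟦X⟧))) (Icc 0 1) := by
    intro n
    simp_rw [coeff_smul]
    fun_prop
  refine continuousOn_coeff_mul (fun n => continuousOn_coeff_expS
    (fun u _ => l1_smul_X_sub_one_ne_top _) hlin n) (continuousOn_coeff_mul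
    (fun n => continuousOn_coeff_expS (fun u hu => l1_immigration_ne_top hL hu a) (fun n => ?_) n)
    fun n => continuousOn_coeff_thinning (l1_X_pow_ne_top m) n) n
  simp_rw [immigration, map_sub (coeff n)]
  exact (continuousOn_const.sub (continuousOn_coeff_thinning hL n)).sub (hlin n)

variable (hmono : ∀ ⦃i j : ℕ⦄, 1 ≤ i → i ≤ j → (j : ℝ) * coeff j L ≤ i * coeff i L)
include hmono

/-- The removed Poisson part affects positive degrees only in degree one, where
`coeff_one_thinning_le` leaves room for it. -/
theorem coeff_immigration_nonneg {u : ℝ} (hu : u ∈ Ico (0 : ℝ) 1) (n : ℕ) :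
    0 ≤ coeff (n + 1) (immigration L (coeff 1 L - 2 * coeff 2 L) u) := by
  rw [immigration, map_sub, map_sub, coeff_smul, map_sub, coeff_X, coeff_one,
    if_neg (Nat.succ_ne_zero n), sub_zero]
  cases n with
  | zero =>
    have := coeff_one_thinning_le hL hmono hu
    simp only [zero_add, if_true, smul_eq_mul, mul_one]
    linarith
  | succ n =>
    have := coeff_thinning_le hL hmono hu (n + 1)
    rw [if_neg (by omega), smul_zero]
    linarith

theorem l1_immigrationDeath_right {u : ℝ} (hu : u ∈ Ico (0 : ℝ) 1) (m : ℕ) :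
    l1 (expS (immigration L (coeff 1 L - 2 * coeff 2 L) u) * thinning (X ^ m) u) = 1 := by
  have hu' : u ∈ Icc (0 : ℝ) 1 := ⟨hu.1, hu.2.le⟩
  rw [l1_eq_ofReal_ev_one (l1_immigrationDeath_right_ne_top hL hu' _ m),
    ev_immigrationDeath_right hL hu' _ m (by simp)]
  · simp
  · refine coeff_mul_nonneg (coeff_expS_nonneg_of_succ (l1_immigration_ne_top hL hu' _)
      (coeff_immigration_nonneg hL hmono hu))
      (coeff_thinning_nonneg (l1_X_pow_ne_top m) (fun n => ?_) hu')
    rw [coeff_X_pow]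
    split_ifs <;> norm_num

theorem l1_one_sub_X_mul_immigrationDeath_le {u : ℝ} (hu : u ∈ Ioo (0 : ℝ) 1) (m : ℕ) :
    l1 ((1 - X) * immigrationDeath L (coeff 1 L - 2 * coeff 2 L) m u) ≤ 2 ∧
      (0 < coeff 1 L - 2 * coeff 2 L →
        l1 ((1 - X) * immigrationDeath L (coeff 1 L - 2 * coeff 2 L) m u) ≤
          ENNReal.ofReal (√((coeff 1 L - 2 * coeff 2 L) * u))⁻¹) := by
  have ha : 0 ≤ coeff 1 L - 2 * coeff 2 L := by
    have := hmono (i := 1) (j := 2) le_rfl (by norm_num)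
    push_cast at this
    linarith
  -- The remaining factor is a probability series, and convolution with it does not increase the
  -- norm.
  have h : l1 ((1 - X) * immigrationDeath L (coeff 1 L - 2 * coeff 2 L) m u) ≤
      l1 ((1 - X) * poissonSeries ((coeff 1 L - 2 * coeff 2 L) * u)) := by
    rw [immigrationDeath, ← mul_assoc]
    refine (l1_mul_le _ _).trans (le_of_eq ?_)
    rw [l1_immigrationDeath_right hL hmono ⟨hu.1.le, hu.2⟩, mul_one]
  refine ⟨h.trans ?_, fun ha' => h.trans (l1_one_sub_X_mul_poissonSeries_le (mul_pos ha' hu.1))⟩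
  refine (l1_mul_le _ _).trans ?_
  rw [l1_poissonSeries (mul_nonneg ha hu.1.le), mul_one]
  refine (l1_sub_le _ _).trans ?_
  rw [l1_one, l1_X, one_add_one_eq_two]

theorem lintegral_l1_one_sub_X_mul_immigrationDeath_le (m : ℕ) :
    ∫⁻ u in Ioo (0 : ℝ) 1, l1 ((1 - X) * immigrationDeath L (coeff 1 L - 2 * coeff 2 L) m u) ≤ 2 ∧
      (0 < coeff 1 L - 2 * coeff 2 L →
        ∫⁻ u in Ioo (0 : ℝ) 1, l1 ((1 - X) * immigrationDeath L (coeff 1 L - 2 * coeff 2 L) m u) ≤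
          ENNReal.ofReal (2 * (√(coeff 1 L - 2 * coeff 2 L))⁻¹)) := by
  refine ⟨?_, fun ha => ?_⟩
  · refine (setLIntegral_mono' measurableSet_Ioo fun u hu =>
      (l1_one_sub_X_mul_immigrationDeath_le hL hmono hu m).1).trans ?_
    simp
  · rw [← lintegral_inv_sqrt_mul ha]
    exact setLIntegral_mono' measurableSet_Ioo fun u hu =>
      (l1_one_sub_X_mul_immigrationDeath_le hL hmono hu m).2 ha

/-- Substituting `s = (1 - z) u + z` in `ev_steinSol`; the Jacobian `1 - z` is the factor `1 - X`.
-/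
theorem steinSol_eq_mixture (m : ℕ) :
    steinSol L m =
      mixture fun u => (1 - X) * immigrationDeath L (coeff 1 L - 2 * coeff 2 L) m u := by
  have h1X : l1 (1 - X) ≠ ∞ := l1_sub_ne_top (by simp [l1_one]) (by simp [l1_X])
  have hc : ∀ n, ContinuousOn (fun u => coeff n
      ((1 - X) * immigrationDeath L (coeff 1 L - 2 * coeff 2 L) m u)) (Icc 0 1) :=
    continuousOn_coeff_mul (fun n => continuousOn_const)
      fun n => continuousOn_coeff_immigrationDeath hL _ m n
  have hfin := ne_top_of_le_ne_top ENNReal.ofNat_ne_top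
    (lintegral_l1_one_sub_X_mul_immigrationDeath_le hL hmono m).1
  refine ext_of_ev (l1_steinSol_ne_top hL m) (ne_top_of_le_ne_top hfin (l1_mixture_le hc))
    fun z hz => ?_
  have hz' : |z| ≤ 1 := abs_le.2 ⟨by linarith [hz.1], hz.2.le⟩
  rw [ev_steinSol hL m hz.1.le hz.2.le, ev_mixture hc hfin hz']
  have hev : ∀ u ∈ Ioo (0 : ℝ) 1,
      ev z ((1 - X) * immigrationDeath L (coeff 1 L - 2 * coeff 2 L) m u) =
        Real.exp (ev z L) * (1 - z) *
          (((1 - z) * u + z) ^ m * Real.exp (-ev ((1 - z) * u + z) L)) := by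
    intro u hu
    have hu' : u ∈ Icc (0 : ℝ) 1 := ⟨hu.1.le, hu.2.le⟩
    rw [ev_mul h1X (l1_immigrationDeath_ne_top hL hu' _ m) hz', ev_sub (by simp [l1_one])
      (by simp [l1_X]) hz', ev_one, ev_X, ev_immigrationDeath hL hu' _ m hz', sub_eq_add_neg
      (ev z L), Real.exp_add, show u + (1 - u) * z = (1 - z) * u + z by ring]
    ring
  rw [setIntegral_congr_fun measurableSet_Ioo hev, integral_const_mul,
    ← integral_Ioc_eq_integral_Ioo, ← intervalIntegral.integral_of_le zero_le_one, mul_assoc]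
  have := intervalIntegral.smul_integral_comp_mul_add (a := 0) (b := 1)
    (fun s => s ^ m * Real.exp (-ev s L)) (1 - z) z
  rw [smul_eq_mul, mul_zero, zero_add, mul_one, sub_add_cancel] at this
  rw [this]

theorem l1_steinSol_le_of_monotone (m : ℕ) :
    l1 (steinSol L m) ≤ 2 ∧ (0 < coeff 1 L - 2 * coeff 2 L →
      l1 (steinSol L m) ≤ ENNReal.ofReal (2 * (√(coeff 1 L - 2 * coeff 2 L))⁻¹)) := by
  have hc : ∀ n, ContinuousOn (fun u => coeff n
      ((1 - X) * immigrationDeath L (coeff 1 L - 2 * coeff 2 L) m u)) (Icc 0 1) :=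
    continuousOn_coeff_mul (fun n => continuousOn_const)
      fun n => continuousOn_coeff_immigrationDeath hL _ m n
  have h := lintegral_l1_one_sub_X_mul_immigrationDeath_le hL hmono m
  rw [steinSol_eq_mixture hL hmono m]
  exact ⟨(l1_mixture_le hc).trans h.1, fun ha => (l1_mixture_le hc).trans (h.2 ha)⟩

end immigrationDeath

/-! ### Generating series of probability distributions -/

/-- The generating series of a distribution on `ℕ`. -/
def pmfSeries (P : PMF ℕ) : ℝ⟦X⟧ := mk fun n => (P n).toReal

theorem coeff_pmfSeries (P : PMF ℕ) (n : ℕ) : coeff n (pmfSeries P) = (P n).toReal := coeff_mk _ _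

theorem l1_pmfSeries (P : PMF ℕ) : l1 (pmfSeries P) = 1 := by
  rw [l1, ← P.tsum_coe]
  refine tsum_congr fun n => ?_
  rw [coeff_pmfSeries, Real.enorm_of_nonneg ENNReal.toReal_nonneg,
    ENNReal.ofReal_toReal (P.apply_ne_top n)]

theorem ev_one_pmfSeries (P : PMF ℕ) : ev 1 (pmfSeries P) = 1 := by
  have h := ENNReal.tsum_toReal_eq P.apply_ne_top
  rw [P.tsum_coe, ENNReal.toReal_one] at h
  exact (tsum_congr fun n => by rw [coeff_pmfSeries, one_pow, mul_one]).trans h.symm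

theorem pmf_map_add_apply (Q : PMF ℕ) (s n : ℕ) :
    Q.map (fun x => s + x) n = if s ≤ n then Q (n - s) else 0 := by
  rw [PMF.map_apply]
  split_ifs with h
  · refine (tsum_eq_single (n - s) fun x hx => if_neg (by omega)).trans (if_pos (by omega))
  · exact ENNReal.tsum_eq_zero.2 fun x => if_neg (by omega)

theorem pmfSeries_bind_map_add (R Q : PMF ℕ) :
    pmfSeries (R.bind fun s => Q.map fun x => s + x) = pmfSeries R * pmfSeries Q := by
  ext n
  rw [coeff_pmfSeries, PMF.bind_apply, coeff_mul,
    Finset.Nat.sum_antidiagonal_eq_sum_range_succ_mk,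
    tsum_eq_sum (s := Finset.range n.succ) fun s hs => by
      rw [pmf_map_add_apply, if_neg (by simpa using hs), mul_zero],
    ENNReal.toReal_sum fun s _ => ENNReal.mul_ne_top (R.apply_ne_top s) (PMF.apply_ne_top _ _)]
  refine Finset.sum_congr rfl fun s hs => ?_
  rw [pmf_map_add_apply, if_pos (by simpa [Nat.lt_succ_iff] using hs), ENNReal.toReal_mul,
    coeff_pmfSeries, coeff_pmfSeries]

theorem pmfSeries_iidSum (Q : PMF ℕ) (k : ℕ) : pmfSeries (iidSum Q k) = pmfSeries Q ^ k := by
  induction k with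
  | zero =>
    ext n
    rw [coeff_pmfSeries, iidSum, PMF.pure_apply, pow_zero, coeff_one]
    split_ifs <;> simp
  | succ k ih => rw [iidSum, pmfSeries_bind_map_add, ih, pow_succ]

theorem l1_smul_pmfSeries_ne_top (lam : ℝ) (Q : PMF ℕ) : l1 (lam • pmfSeries Q) ≠ ∞ :=
  l1_smul_ne_top _ (by simp [l1_pmfSeries])

theorem ev_one_smul_pmfSeries (lam : ℝ) (Q : PMF ℕ) : ev 1 (lam • pmfSeries Q) = lam := by
  rw [ev_smul, ev_one_pmfSeries, mul_one]

/-- Conditioning on the Poisson number of summands reproduces the exponential series term by term.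
-/
theorem pmfSeries_compoundPoisson {lam : ℝ} (hlam : 0 < lam) (Q : PMF ℕ) :
    pmfSeries (compoundPoisson lam Q) = Real.exp (-lam) • expS (lam • pmfSeries Q) := by
  ext n
  rw [coeff_pmfSeries, compoundPoisson, compoundPMF, PMF.bind_apply, ENNReal.tsum_toReal_eq
    fun k => ENNReal.mul_ne_top (PMF.apply_ne_top _ _) (PMF.apply_ne_top _ _), coeff_smul,
    coeff_expS, smul_eq_mul, ← tsum_mul_left]
  refine tsum_congr fun k => ?_
  rw [ENNReal.toReal_mul, ← coeff_pmfSeries (iidSum Q k), pmfSeries_iidSum, Measure.toPMF_apply,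
    ← Measure.real, ProbabilityTheory.poissonMeasure_real_singleton,
    Real.coe_toNNReal _ hlam.le, smul_pow, coeff_smul, smul_eq_mul]
  ring

theorem tvDist_eq_l1 (P R : PMF ℕ) :
    ENNReal.ofReal (tvDist P R) = 2⁻¹ * l1 (pmfSeries P - pmfSeries R) := by
  have h : l1 (pmfSeries P - pmfSeries R) ≠ ∞ :=
    l1_sub_ne_top (by simp [l1_pmfSeries]) (by simp [l1_pmfSeries])
  rw [tvDist, ENNReal.ofReal_mul (by norm_num), one_div, ENNReal.ofReal_inv_of_pos two_pos,
    ENNReal.ofReal_ofNat]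
  congr 1
  have hs : Summable fun x => |(P x).toReal - (R x).toReal| := by
    simpa [coeff_pmfSeries] using summable_abs_coeff h
  rw [ENNReal.ofReal_tsum_of_nonneg (fun _ => abs_nonneg _) hs]
  exact tsum_congr fun n => by
    rw [map_sub, coeff_pmfSeries, coeff_pmfSeries, Real.enorm_eq_ofReal_abs]

/-! ### The Katti-Panjer information -/

/-- The series with coefficients `P(m + 1) r₂(m + 1; P, Q)`. -/
def scoreSeries (lam : ℝ) (P Q : PMF ℕ) : ℝ⟦X⟧ :=
  d⁄dX ℝ (lam • pmfSeries Q) * pmfSeries P - d⁄dX ℝ (pmfSeries P)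

theorem coeff_scoreSeries (lam : ℝ) {P : PMF ℕ} (Q : PMF ℕ) (hP : ∀ y, P y ≠ 0) (m : ℕ) :
    coeff m (scoreSeries lam P Q) =
      (P (m + 1)).toReal * kattiPanjerScore lam P Q (m + 1) := by
  have hp : (P (m + 1)).toReal ≠ 0 := ENNReal.toReal_ne_zero.2 ⟨hP _, P.apply_ne_top _⟩
  rw [scoreSeries, map_sub, coeff_mul, coeff_derivative, coeff_pmfSeries, kattiPanjerScore,
    mul_sub, mul_div_cancel₀ _ hp, Finset.Nat.sum_antidiagonal_eq_sum_range_succ_mk,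
    Finset.range_eq_Ico, Finset.mul_sum]
  push_cast
  congr 1
  rw [← Finset.Ico_add_one_right_eq_Icc, ← Finset.sum_Ico_add' _ 0 (m + 1) 1]
  refine Finset.sum_congr rfl fun j _ => ?_
  rw [coeff_derivative, coeff_smul, coeff_pmfSeries, coeff_pmfSeries, smul_eq_mul,
    Nat.add_sub_add_right]
  push_cast
  ring

theorem l1_scoreSeries_le (lam : ℝ) (P Q : PMF ℕ) :
    l1 (scoreSeries lam P Q) ≤ kattiPanjerInfo lam P Q ^ (1 / 2 : ℝ) := by
  rw [kattiPanjerInfo]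
  split_ifs with hP
  swap
  · simp
  have hmeas : ∀ f : ℕ → ℝ≥0∞, Measurable f := fun f => measurable_of_countable f
  calc l1 (scoreSeries lam P Q)
      = ∑' m, ENNReal.ofReal |kattiPanjerScore lam P Q (m + 1)| * P (m + 1) := by
        refine tsum_congr fun m => ?_
        rw [coeff_scoreSeries lam Q hP, enorm_mul, mul_comm, Real.enorm_eq_ofReal_abs,
          Real.enorm_of_nonneg ENNReal.toReal_nonneg, ENNReal.ofReal_toReal (P.apply_ne_top _)]
    -- Differentiation has lost `y = 0`, whose nonnegative term is restored here; Cauchy–Schwarz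
    -- against `1` follows.
    _ ≤ ∑' y, ENNReal.ofReal |kattiPanjerScore lam P Q y| * P y :=
        ENNReal.tsum_comp_le_tsum_of_injective (add_left_injective 1) _
    _ = ∫⁻ y, ENNReal.ofReal |kattiPanjerScore lam P Q y| ∂P.toMeasure := by
        rw [lintegral_countable']
        exact tsum_congr fun y => by rw [P.toMeasure_apply_singleton _ (measurableSet_singleton y)]
    _ ≤ (∫⁻ y, ENNReal.ofReal (kattiPanjerScore lam P Q y ^ 2) ∂P.toMeasure) ^ (1 / 2 : ℝ) := by
        have h := ENNReal.lintegral_mul_le_Lp_mul_Lq P.toMeasure Real.HolderConjugate.two_two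
          (f := fun y => ENNReal.ofReal |kattiPanjerScore lam P Q y|) (g := fun _ => 1)
          (hmeas _).aemeasurable (hmeas _).aemeasurable
        simp only [Pi.mul_apply, mul_one, ENNReal.one_rpow, lintegral_const, measure_univ] at h
        refine h.trans (le_of_eq ?_)
        congr 1
        refine lintegral_congr fun y => ?_
        rw [ENNReal.rpow_two, ← ENNReal.ofReal_pow (abs_nonneg _), sq_abs]

/-! ### The Stein factor -/

theorem toReal_min_one_inv_pos (a : ℝ) : 0 < (min 1 (ENNReal.ofReal a)⁻¹).toReal := by
  refine ENNReal.toReal_pos (lt_min one_pos ?_).ne' (ne_top_of_le_ne_top ENNReal.one_ne_top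
    (min_le_left _ _))
  exact ENNReal.inv_pos.2 ENNReal.ofReal_ne_top

theorem sqrt_toReal_steinDelta {lam : ℝ} {Q : PMF ℕ} (h : ¬1 ≤ steinDelta lam Q) :
    1 < lam * ((Q 1).toReal - 2 * (Q 2).toReal) ∧ √(steinDelta lam Q).toReal =
      (√(lam * ((Q 1).toReal - 2 * (Q 2).toReal)))⁻¹ := by
  have h1 : 1 < lam * ((Q 1).toReal - 2 * (Q 2).toReal) := by
    rw [steinDelta, not_le, ENNReal.inv_lt_one] at h
    exact ENNReal.one_lt_ofReal.1 h
  refine ⟨h1, ?_⟩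
  rw [steinDelta, ENNReal.toReal_inv, ENNReal.toReal_ofReal (by linarith), Real.sqrt_inv]

/-- With `√δ = (√a)⁻¹ ≤ 1`, the factor `2 - √δ` is at least `1`, so a bound by `√δ` suffices. -/
theorem inv_sqrt_le_steinFactorZero {a : ℝ} (ha : 1 < a) :
    0 < (√a)⁻¹ ∧ (√a)⁻¹ ≤ (√a)⁻¹ * (2 - (√a)⁻¹) := by
  have h0 : 0 < (√a)⁻¹ := inv_pos.2 (Real.sqrt_pos.2 (by linarith))
  have h1 : (√a)⁻¹ ≤ 1 := inv_le_one_of_one_le₀ (Real.one_le_sqrt.2 ha.le)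
  exact ⟨h0, by nlinarith⟩

theorem steinFactor_pos (lam : ℝ) (Q : PMF ℕ) : 0 < steinFactor lam Q := by
  rw [steinFactor, steinFactorZero]
  split_ifs with h1 h2
  · exact one_pos
  · obtain ⟨ha, hs⟩ := sqrt_toReal_steinDelta h2
    rw [hs]
    exact (inv_sqrt_le_steinFactorZero ha).1.trans_le (inv_sqrt_le_steinFactorZero ha).2
  · exact mul_pos (Real.exp_pos _) (toReal_min_one_inv_pos _)

theorem l1_steinSol_smul_pmfSeries_le {lam : ℝ} (hlam : 0 < lam) (Q : PMF ℕ) (m : ℕ) :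
    l1 (steinSol (lam • pmfSeries Q) m) ≤ ENNReal.ofReal (2 * steinFactor lam Q) := by
  have hL := l1_smul_pmfSeries_ne_top lam Q
  have hcoeff : ∀ n, coeff n (lam • pmfSeries Q) = lam * (Q n).toReal := fun n => by
    rw [coeff_smul, coeff_pmfSeries, smul_eq_mul]
  have h0 : ∀ n, 0 ≤ coeff n (lam • pmfSeries Q) := fun n => by
    rw [hcoeff]; exact mul_nonneg hlam.le ENNReal.toReal_nonneg
  rw [steinFactor]
  split_ifs with hQ
  · have h := l1_steinSol_le_of_monotone hL (fun i j hi hij => by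
      rw [hcoeff, hcoeff, mul_left_comm, mul_left_comm (i : ℝ)]
      exact mul_le_mul_of_nonneg_left (hQ (Set.mem_Ici.2 hi) (Set.mem_Ici.2 (hi.trans hij)) hij)
        hlam.le) m
    rw [hcoeff, hcoeff, mul_left_comm 2, ← mul_sub] at h
    rw [steinFactorZero]
    split_ifs with hδ
    · simpa using h.1
    · obtain ⟨ha, hs⟩ := sqrt_toReal_steinDelta hδ
      rw [hs]
      refine (h.2 (by linarith)).trans (ENNReal.ofReal_le_ofReal ?_)
      linarith [(inv_sqrt_le_steinFactorZero ha).2]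
  · refine (l1_steinSol_le hL m h0).trans (ENNReal.ofReal_le_ofReal ?_)
    rw [ev_one_smul_pmfSeries]
    have h := integral_pow_mul_exp_neg_ev_le hL h0 m
    rw [hcoeff] at h
    gcongr
    rcases le_total 1 (ENNReal.ofReal (lam * (Q 1).toReal))⁻¹ with h1 | h1
    · rw [min_eq_left h1, ENNReal.toReal_one]
      exact h.1
    · have hpos : 0 < lam * (Q 1).toReal := by
        by_contra hn
        rw [ENNReal.ofReal_of_nonpos (not_lt.1 hn)] at h1
        simp at h1
      rw [min_eq_right h1, ENNReal.toReal_inv, ENNReal.toReal_ofReal hpos.le]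
      exact h.2 hpos

end CompoundPoissonStein
end

/-! ### The total variation bound -/

open CompoundPoissonStein in
theorem mainTheorem5 (P Q : PMF ℕ) (hQ : Q 0 = 0) (lam : ℝ) (hlam : 0 < lam) :
    ENNReal.ofReal (tvDist P (compoundPoisson lam Q)) ≤
      ENNReal.ofReal (steinFactor lam Q) * (kattiPanjerInfo lam P Q) ^ (1 / 2 : ℝ) := by
  -- Since `0 * ∞ = 0`, infinite information makes the bound trivial only because the Stein factor
  -- is positive.
  have hH : ENNReal.ofReal (steinFactor lam Q) ≠ 0 :=
    (ENNReal.ofReal_pos.2 (steinFactor_pos lam Q)).ne'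
  by_cases hJ : kattiPanjerInfo lam P Q ^ (1 / 2 : ℝ) = ∞
  · rw [hJ, ENNReal.mul_top hH]
    exact le_top
  have hA := l1_scoreSeries_le lam P Q
  have h := l1_sub_smul_expS_le (P := pmfSeries P) (A := scoreSeries lam P Q)
    (l1_smul_pmfSeries_ne_top lam Q) (by simp [l1_pmfSeries]) (ev_one_pmfSeries P)
    (by rw [scoreSeries, sub_sub_cancel]) (ne_top_of_le_ne_top hJ hA) ENNReal.ofReal_ne_top
    (l1_steinSol_smul_pmfSeries_le hlam Q)
  rw [ev_one_smul_pmfSeries, ← pmfSeries_compoundPoisson hlam] at h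
  rw [tvDist_eq_l1]
  calc 2⁻¹ * l1 (pmfSeries P - pmfSeries (compoundPoisson lam Q))
      ≤ 2⁻¹ * (ENNReal.ofReal (2 * steinFactor lam Q) * kattiPanjerInfo lam P Q ^ (1 / 2 : ℝ)) := by
        gcongr
        exact h.trans (by gcongr)
    _ = ENNReal.ofReal (steinFactor lam Q) * kattiPanjerInfo lam P Q ^ (1 / 2 : ℝ) := by
        rw [ENNReal.ofReal_mul two_pos.le, ENNReal.ofReal_ofNat, mul_assoc, ← mul_assoc,
          ENNReal.inv_mul_cancel two_ne_zero ENNReal.ofNat_ne_top, one_mul]
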